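/- All graphs are finite, undirected and simple. For a graph $H$ and $k\ge 1$, the power $H^k$ is the graph on $V_H$ in which $x,y$ are adjacent iff $1\le d_H(x,y)\le k$. We write $N_G(x)$ for the neighborhood of $x$ in $G$ and $N_G[x]=N_G(x)\cup\{x\}$; a graph is $\{C_3,C_5\}$-free if it contains no cycle of length $3$ or $5$. (i) Let $H$ be a $\{C_3,C_5\}$-free graph and $G=H^2$. Then for every vertex $x$ and every $y\in N_H(x)$, $$N_H(y)=N_G(y)\cap\bigl(N_G[x]\setminus N_H(x)\bigr).$$ (ii) Let $G$ be a connected graph, $v\in V_G$ and $U\subseteq N_G(v)$. Then there is at most one $\{C_3,C_5\}$-free graph $H$ on $V_G$ with $H^2=G$ and $N_H(v)=U$. (iii) Consider the following problem: given a connected graph $G$ on $n$ vertices (by its adjacency matrix), $v\in V_G$ and $U\subseteq N_G(v)$, output the (adjacency matrix of the) $\{C_3,C_5\}$-free graph $H$ with $H^2=G$ and $N_H(v)=U$ if it exists, and report NO otherwise. This problem can be solved in time $O(M(n))$, where $M(n)$ is the time needed to multiply two $n\times n$ matrices. Precisely, on a random access machine with unit-cost instructions on words of $O(\log n)$ bits: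 whenever some program multiplies any two $n\times n$ matrices with entries in $\{0,1\}$ over the integers in at most $M(n)$ steps, for all $n$, there are a program and a constant $C$ such that the program solves the problem in at most $C\cdot M(n)$ steps for all $n$. -/

import Mathlib

/-! ### Graphs -/

namespace SquareRoot

/-- The `k`-th power of a graph: `x` and `y` are adjacent iff their distance is between `1` and `k`. -/
def power {V : Type*} (H : SimpleGraph V) (k : ℕ) : SimpleGraph V where
  Adj x y := 1 ≤ H.edist x y ∧ H.edist x y ≤ k
  symm := ⟨fun x y h => by rwa [SimpleGraph.edist_comm]⟩
  loopless := ⟨fun x h => by simp at h⟩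

/-- `H` is `{C₃, C₅}`-free. -/
def C3C5Free {V : Type*} (H : SimpleGraph V) : Prop :=
  (SimpleGraph.cycleGraph 3).Free H ∧ (SimpleGraph.cycleGraph 5).Free H

/-- `H` is a `{C₃, C₅}`-free square root of `G` in which the neighborhood of `v` is `U`. -/
def IsRootWithNbhd {V : Type*} (G : SimpleGraph V) (v : V) (U : Set V) (H : SimpleGraph V) : Prop :=
  C3C5Free H ∧ power H 2 = G ∧ H.neighborSet v = U

/-! ### The machine: a random access machine with unit-cost instructions on bounded words

The memory consists of registers and arrays (indexed by natural numbers), all of whose entries are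
natural numbers. A program is built from elementary instructions by sequencing, branching and
while loops. A program text mentions only finitely many registers and arrays. -/

/-- The arithmetic instructions (subtraction is truncated). -/
inductive Op
  | add | sub | mul | div | mod

/-- The value of an arithmetic instruction. -/
def Op.eval : Op → ℕ → ℕ → ℕ
  | .add, a, b => a + b
  | .sub, a, b => a - b
  | .mul, a, b => a * b
  | .div, a, b => a / b
  | .mod, a, b => a % b

/-- Programs. Arguments `x y z i` name registers, the argument `a` names an array:
* `const x k`: register `x` gets the constant `k`;
* `arith o x y z`: register `x` gets the result of `o` on the contents of registers `y`, `z`;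
* `load x a i`: register `x` gets the entry of array `a` at the position held in register `i`;
* `store a i x`: that entry gets the content of register `x`;
* `branch x p q`: run `p` if register `x` is nonzero, otherwise `q`;
* `loop x p`: while register `x` is nonzero, run `p`. -/
inductive Prog
  | skip : Prog
  | const (x k : ℕ) : Prog
  | arith (o : Op) (x y z : ℕ) : Prog
  | load (x a i : ℕ) : Prog
  | store (a i x : ℕ) : Prog
  | seq (p q : Prog) : Prog
  | branch (x : ℕ) (p q : Prog) : Prog
  | loop (x : ℕ) (p : Prog) : Prog

/-- The content of the memory. -/
structure State where
  /-- the contents of the registers -/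
  reg : ℕ → ℕ
  /-- the contents of the arrays: `arr a k` is the entry of array `a` at position `k` -/
  arr : ℕ → ℕ → ℕ

/-- Overwrite register `x` by `k`. -/
def State.setReg (s : State) (x k : ℕ) : State :=
  { s with reg := Function.update s.reg x k }

/-- Overwrite position `i` of array `a` by `k`. -/
def State.setArr (s : State) (a i k : ℕ) : State :=
  { s with arr := Function.update s.arr a (Function.update (s.arr a) i k) }

/-- `Exec B p s t s'`: started in `s`, the program `p` halts in `s'` after exactly `t` steps, and
every number that it produces on the way is smaller than `B`. Every elementary instruction and
every test of a branch or a loop takes one step. An instruction whose result is not smaller than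
`B` cannot be executed. -/
inductive Exec (B : ℕ) : Prog → State → ℕ → State → Prop
  | skip (s : State) : Exec B .skip s 1 s
  | const (x k : ℕ) (s : State) (h : k < B) : Exec B (.const x k) s 1 (s.setReg x k)
  | arith (o : Op) (x y z : ℕ) (s : State) (h : o.eval (s.reg y) (s.reg z) < B) :
      Exec B (.arith o x y z) s 1 (s.setReg x (o.eval (s.reg y) (s.reg z)))
  | load (x a i : ℕ) (s : State) :
      Exec B (.load x a i) s 1 (s.setReg x (s.arr a (s.reg i)))
  | store (a i x : ℕ) (s : State) :
      Exec B (.store a i x) s 1 (s.setArr a (s.reg i) (s.reg x))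
  | seq {p q : Prog} {s s' s'' : State} {t u : ℕ} (hp : Exec B p s t s') (hq : Exec B q s' u s'') :
      Exec B (.seq p q) s (t + u) s''
  | branch_true {x : ℕ} {p q : Prog} {s s' : State} {t : ℕ} (hx : s.reg x ≠ 0)
      (hp : Exec B p s t s') : Exec B (.branch x p q) s (t + 1) s'
  | branch_false {x : ℕ} {p q : Prog} {s s' : State} {t : ℕ} (hx : s.reg x = 0)
      (hq : Exec B q s t s') : Exec B (.branch x p q) s (t + 1) s'
  | loop_done {x : ℕ} {p : Prog} {s : State} (hx : s.reg x = 0) : Exec B (.loop x p) s 1 s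
  | loop_step {x : ℕ} {p : Prog} {s s' s'' : State} {t u : ℕ} (hx : s.reg x ≠ 0)
      (hp : Exec B p s t s') (hl : Exec B (.loop x p) s' u s'') :
      Exec B (.loop x p) s (t + u + 1) s''

/-! ### Inputs, outputs and running times -/

/-- The array that holds an `n × n` matrix row by row: entry `(i, j)` is at position `i * n + j`.
All other positions hold `0`. -/
def matrixArray {n : ℕ} (A : Matrix (Fin n) (Fin n) ℕ) (k : ℕ) : ℕ :=
  if h : k < n * n then
    A ⟨k / n, Nat.div_lt_of_lt_mul h⟩
      ⟨k % n, Nat.mod_lt k (Nat.pos_of_ne_zero fun h0 => by simp [h0] at h)⟩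
  else 0

open Classical in
/-- The adjacency matrix of a graph on the vertices `0, …, n - 1`. -/
noncomputable def adjacency {n : ℕ} (G : SimpleGraph (Fin n)) : Matrix (Fin n) (Fin n) ℕ :=
  fun i j => if G.Adj i j then 1 else 0

open Classical in
/-- The array that holds the characteristic vector of a set of vertices. -/
noncomputable def setArray {n : ℕ} (U : Set (Fin n)) (k : ℕ) : ℕ :=
  if ∃ u ∈ U, (u : ℕ) = k then 1 else 0

/-- Initial state for multiplying `A` and `B`: `n` is in register `0`, the matrices are in the
arrays `0` and `1`, and the rest of the memory is `0`. -/
def mulInput {n : ℕ} (A B : Matrix (Fin n) (Fin n) ℕ) : State where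
  reg x := if x = 0 then n else 0
  arr a := if a = 0 then matrixArray A else if a = 1 then matrixArray B else fun _ => 0

/-- The program `P` multiplies any two `n × n` matrices with entries in `{0, 1}` (over the
integers) in at most `T n` steps, on words of `O(log n)` bits; the product is left in array `2`.
(A program that multiplies matrices with arbitrary integer entries does so in particular.) -/
def MultipliesMatricesIn (P : Prog) (T : ℕ → ℕ) : Prop :=
  ∃ c : ℕ, ∀ (n : ℕ) (A B : Matrix (Fin n) (Fin n) ℕ),
    (∀ i j, A i j = 0 ∨ A i j = 1) → (∀ i j, B i j = 0 ∨ B i j = 1) →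
    ∃ (t : ℕ) (s : State), Exec ((n + 2) ^ c) P (mulInput A B) t s ∧ t ≤ T n ∧
      ∀ i j : Fin n, s.arr 2 (i * n + j) = (A * B) i j

/-- Initial state for the instance `(G, v, U)`: `n` and `v` are in the registers `0` and `1`, the
adjacency matrix of `G` is in array `0`, the characteristic vector of `U` is in array `1`, and the
rest of the memory is `0`. -/
noncomputable def rootInput {n : ℕ} (G : SimpleGraph (Fin n)) (v : Fin n) (U : Set (Fin n)) :
    State where
  reg x := if x = 0 then n else if x = 1 then v else 0
  arr a := if a = 0 then matrixArray (adjacency G) else if a = 1 then setArray U else fun _ => 0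

/-- On every instance `(G, v, U)` with `G` a connected graph on `n` vertices and `U ⊆ N_G(v)`, the
program `Q` halts after at most `S n` steps, on words of `O(log n)` bits. If there is a
`{C₃, C₅}`-free square root `H` of `G` with `N_H(v) = U`, then register `0` holds `1` at the end and
array `2` holds the adjacency matrix of such an `H`; otherwise register `0` holds `0`. -/
def ConstructsRootIn (Q : Prog) (S : ℕ → ℕ) : Prop :=
  ∃ c : ℕ, ∀ (n : ℕ) (G : SimpleGraph (Fin n)) (v : Fin n) (U : Set (Fin n)),
    G.Connected → U ⊆ G.neighborSet v →
    ∃ (t : ℕ) (s : State), Exec ((n + 2) ^ c) Q (rootInput G v U) t s ∧ t ≤ S n ∧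
      ((∃ H, IsRootWithNbhd G v U H) →
        s.reg 0 = 1 ∧ ∃ H, IsRootWithNbhd G v U H ∧
          ∀ i j : Fin n, s.arr 2 (i * n + j) = adjacency H i j) ∧
      ((¬ ∃ H, IsRootWithNbhd G v U H) → s.reg 0 = 0)

end SquareRoot

namespace SquareRoot

/-! ### Square roots without triangles and pentagons -/

section Graphs

variable {V : Type*} {H : SimpleGraph V}

/-! Let `xy` be an edge of a root `H`. A neighbor `z` of `y` is within distance 2 of `x`, and is not
adjacent to `x` because there are no triangles. Conversely, suppose `z ≠ x` is adjacent in `G` to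
both `x` and `y`, but is adjacent in `H` to neither. Then there are paths `x a z` and `z b y`, which
the edge `xy` completes to a closed walk of length 5; in a triangle-free graph this is a pentagon.
This is `neighborSet_eq_of_adj`: the row of `x` determines the row of `y`. Since `G` is connected,
so is `H`, and the row of `v` determines everything.

The same propagation is an algorithm. A breadth-first search from `v` computes the row of each
vertex from the row of its parent, at constant cost per entry, hence in `O(n²)` steps. If a root
exists, the matrix `A` found this way must be its adjacency matrix (`SearchCorrect.final`). If there
is none, the search still halts with some 0/1 matrix, so `A` has to be verified.

Two multiplications suffice for this. The support `S` of `A²` records walks of length 2 and the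
support of `S²` records walks of length 4. So `A` is a solution iff it is symmetric, vanishes on the
diagonal and on the supports of `A²` and `S²` (no loops, triangles or pentagons), has row `U` at
`v`, and together with `A²` has the off-diagonal support of `G` (`forall_testOk_iff`). Passing to
`S` keeps the factors 0/1, as the given multiplier requires.

The `O(n²)` work is absorbed because `n² ≤ M n`: the product of two all-ones matrices has `n²`
nonzero entries, all of which must be written (`MultipliesMatricesIn.sq_le`). -/

theorem power_two_adj_iff {x y : V} :
    (power H 2).Adj x y ↔ x ≠ y ∧ (H.Adj x y ∨ ∃ a, H.Adj x a ∧ H.Adj a y) := by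
  change (1 ≤ H.edist x y ∧ H.edist x y ≤ (2 : ℕ)) ↔ _
  rw [Order.one_le_iff_ne_zero, Ne, SimpleGraph.edist_eq_zero_iff]
  refine and_congr_right fun hne => ⟨fun h => ?_, fun h => ?_⟩
  · have hfin : H.edist x y ≠ ⊤ := fun ht => by simp [ht] at h
    obtain ⟨w, hw⟩ := SimpleGraph.exists_walk_of_edist_ne_top hfin
    rw [← hw] at h
    have hlen : w.length ≤ 2 := by exact_mod_cast h
    cases w with
    | nil => exact absurd rfl hne
    | cons h₁ w =>
      cases w with
      | nil => exact Or.inl h₁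
      | cons h₂ w =>
        cases w with
        | nil => exact Or.inr ⟨_, h₁, h₂⟩
        | cons h₃ w => simp only [SimpleGraph.Walk.length_cons] at hlen; omega
  · rcases h with h | ⟨a, h₁, h₂⟩
    · exact (SimpleGraph.edist_le h.toWalk).trans (by simp)
    · exact (SimpleGraph.edist_le (.cons h₁ (.cons h₂ .nil))).trans (by simp)

theorem free_cycleGraph_three_iff :
    (SimpleGraph.cycleGraph 3).Free H ↔ ∀ x y z, H.Adj x y → H.Adj y z → ¬ H.Adj x z := by
  constructor
  · intro hf x y z hxy hyz hxz
    refine hf ⟨⟨⟨![x, y, z], ?_⟩, ?_⟩⟩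
    · intro i j hij
      fin_cases i <;> fin_cases j <;>
        simp_all [SimpleGraph.cycleGraph_adj, SimpleGraph.adj_comm]
    · have := hxy.ne
      have := hyz.ne
      have := hxz.ne
      intro i j hij
      fin_cases i <;> fin_cases j <;> simp_all
  · rintro h ⟨f⟩
    have adj : ∀ i j : Fin 3, (SimpleGraph.cycleGraph 3).Adj i j → H.Adj (f i) (f j) :=
      fun i j hij => f.toHom.map_adj hij
    exact h (f 0) (f 1) (f 2) (adj _ _ (by decide)) (adj _ _ (by decide))
      (adj _ _ (by decide))

/-- In a triangle-free graph, the closed walks of length `5` are the pentagons. -/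
theorem free_cycleGraph_five_iff (h₃ : ∀ x y z, H.Adj x y → H.Adj y z → ¬ H.Adj x z) :
    (SimpleGraph.cycleGraph 5).Free H ↔
      ∀ x a z b y, H.Adj x a → H.Adj a z → H.Adj z b → H.Adj b y → ¬ H.Adj x y := by
  constructor
  · intro hf x a z b y hxa haz hzb hby hxy
    have n₁ := hxa.ne
    have n₂ := haz.ne
    have n₃ := hzb.ne
    have n₄ := hby.ne
    have n₅ := hxy.ne
    -- Identifying two nonconsecutive vertices of a closed 5-walk leaves a closed 3-walk, that is, a
    -- triangle.
    have n₆ : x ≠ z := by rintro rfl; exact h₃ _ _ _ hzb hby hxy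
    have n₇ : a ≠ b := by rintro rfl; exact h₃ _ _ _ hxa hby hxy
    have n₈ : z ≠ y := by rintro rfl; exact h₃ _ _ _ hxa haz hxy
    have n₉ : b ≠ x := by rintro rfl; exact h₃ _ _ _ hxa haz hzb.symm
    have n₁₀ : y ≠ a := by rintro rfl; exact h₃ _ _ _ haz hzb hby.symm
    refine hf ⟨⟨⟨![x, a, z, b, y], ?_⟩, ?_⟩⟩
    · intro i j hij
      have : j = i + 1 ∨ i = j + 1 := by revert i j; decide
      rcases this with rfl | rfl
      · fin_cases i <;> first | assumption | exact hxy.symm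
      · symm
        fin_cases j <;> first | assumption | exact hxy.symm
    · intro i j hij
      fin_cases i <;> fin_cases j <;> first | rfl | (exfalso; simp at hij; grind)
  · rintro h ⟨f⟩
    have adj : ∀ i j : Fin 5, (SimpleGraph.cycleGraph 5).Adj i j → H.Adj (f i) (f j) :=
      fun i j hij => f.toHom.map_adj hij
    exact h (f 0) (f 1) (f 2) (f 3) (f 4) (adj _ _ (by decide)) (adj _ _ (by decide))
      (adj _ _ (by decide)) (adj _ _ (by decide)) (adj _ _ (by decide))

theorem c3C5Free_iff : C3C5Free H ↔
    (∀ x y z, H.Adj x y → H.Adj y z → ¬ H.Adj x z) ∧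
      ∀ x a z b y, H.Adj x a → H.Adj a z → H.Adj z b → H.Adj b y → ¬ H.Adj x y := by
  unfold C3C5Free
  rw [free_cycleGraph_three_iff]
  exact and_congr_right free_cycleGraph_five_iff

theorem neighborSet_eq_of_adj (hH : C3C5Free H) {x y : V} (hxy : H.Adj x y) :
    H.neighborSet y = (power H 2).neighborSet y ∩
      (insert x ((power H 2).neighborSet x) \ H.neighborSet x) := by
  obtain ⟨h₃, h₅⟩ := c3C5Free_iff.1 hH
  ext z
  simp only [SimpleGraph.mem_neighborSet, Set.mem_inter_iff, Set.mem_sdiff, Set.mem_insert_iff,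
    power_two_adj_iff]
  constructor
  · intro hyz
    refine ⟨⟨hyz.ne, Or.inl hyz⟩, ?_, h₃ _ _ _ hxy hyz⟩
    by_cases hz : z = x
    · exact Or.inl hz
    · exact Or.inr ⟨Ne.symm hz, Or.inr ⟨y, hxy, hyz⟩⟩
  · rintro ⟨⟨-, hyz⟩, hxz, hnxz⟩
    rcases hxz with rfl | ⟨-, hxz⟩
    · exact hxy.symm
    rcases hyz with hyz | ⟨b, hyb, hbz⟩
    · exact hyz
    rcases hxz with hxz | ⟨a, hxa, haz⟩
    · exact absurd hxz hnxz
    exact absurd hxy (h₅ x a z b y hxa haz hbz.symm hyb.symm)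

theorem reachable_of_power_two_connected (hG : (power H 2).Connected) (x y : V) :
    H.Reachable x y := by
  obtain ⟨w⟩ := hG.preconnected x y
  induction w with
  | nil => exact .refl _
  | cons h _ ih =>
    refine .trans ?_ ih
    rcases (power_two_adj_iff.1 h).2 with h | ⟨a, h₁, h₂⟩
    · exact h.reachable
    · exact h₁.reachable.trans h₂.reachable

/-- A set that contains `v` and is closed under adjacency is everything. -/
theorem forall_of_power_two_connected (hG : (power H 2).Connected) {S : V → Prop} {v : V}
    (hv : S v) (hS : ∀ x y, S x → H.Adj x y → S y) (y : V) : S y := by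
  obtain ⟨w⟩ := reachable_of_power_two_connected hG v y
  induction w with
  | nil => exact hv
  | cons h _ ih => exact ih (hS _ _ hv h)

/-- Equality of the two neighborhoods passes along edges of `H₁`: where the neighborhoods of `x`
agree, an edge at `x` lies in both graphs, and the neighborhood formula has the same right-hand side
for both. -/
theorem IsRootWithNbhd.unique {G : SimpleGraph V} (hG : G.Connected) {v : V} {U : Set V}
    {H₁ H₂ : SimpleGraph V} (h₁ : IsRootWithNbhd G v U H₁) (h₂ : IsRootWithNbhd G v U H₂) :
    H₁ = H₂ := by
  obtain ⟨hf₁, rfl, rfl⟩ := h₁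
  obtain ⟨hf₂, hp, hv⟩ := h₂
  have key : ∀ y, H₁.neighborSet y = H₂.neighborSet y := by
    refine forall_of_power_two_connected hG (v := v) hv.symm fun x y hx hxy => ?_
    have hxy₂ : H₂.Adj x y := by
      rw [← SimpleGraph.mem_neighborSet, ← hx]
      exact hxy
    rw [neighborSet_eq_of_adj hf₁ hxy, neighborSet_eq_of_adj hf₂ hxy₂, hp, hx]
  ext x y
  exact Set.ext_iff.1 (key x) y

end Graphs

end SquareRoot

namespace SquareRoot

/-! ### Reasoning about programs -/

/-- The registers that a program may write. -/
def Prog.writtenRegs : Prog → List ℕ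
  | .skip => []
  | .const x _ => [x]
  | .arith _ x _ _ => [x]
  | .load x _ _ => [x]
  | .store _ _ _ => []
  | .seq p q => p.writtenRegs ++ q.writtenRegs
  | .branch _ p q => p.writtenRegs ++ q.writtenRegs
  | .loop _ p => p.writtenRegs

/-- The arrays that a program may write. -/
def Prog.writtenArrs : Prog → List ℕ
  | .skip => []
  | .const _ _ => []
  | .arith _ _ _ _ => []
  | .load _ _ _ => []
  | .store a _ _ => [a]
  | .seq p q => p.writtenArrs ++ q.writtenArrs
  | .branch _ p q => p.writtenArrs ++ q.writtenArrs
  | .loop _ p => p.writtenArrs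

variable {B : ℕ} {p : Prog} {s s' : State} {t : ℕ}

/-- Frame property; for the concrete programs below the side condition is settled by `decide`. -/
theorem Exec.reg_eq (h : Exec B p s t s') {x : ℕ} (hx : x ∉ p.writtenRegs) :
    s'.reg x = s.reg x := by
  induction h <;> simp_all [Prog.writtenRegs, State.setReg, State.setArr]

theorem Exec.arr_eq (h : Exec B p s t s') {a : ℕ} (ha : a ∉ p.writtenArrs) :
    s'.arr a = s.arr a := by
  induction h <;> simp_all [Prog.writtenArrs, State.setReg, State.setArr]

theorem Exec.mono {B' : ℕ} (h : Exec B p s t s') (hB : B ≤ B') : Exec B' p s t s' := by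
  induction h with
  | skip => exact .skip _
  | const _ _ _ h => exact .const _ _ _ (h.trans_le hB)
  | arith _ _ _ _ _ h => exact .arith _ _ _ _ _ (h.trans_le hB)
  | load => exact .load _ _ _ _
  | store => exact .store _ _ _ _
  | seq _ _ ihp ihq => exact .seq ihp ihq
  | branch_true hx _ ih => exact .branch_true hx ih
  | branch_false hx _ ih => exact .branch_false hx ih
  | loop_done hx => exact .loop_done hx
  | loop_step hx _ _ ihp ihl => exact .loop_step hx ihp ihl

/-! ### A quadratic lower bound for matrix multiplication -/

/-- A computation of `t` steps changes at most `t` positions of an array. -/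
theorem Exec.exists_changed (h : Exec B p s t s') (a : ℕ) :
    ∃ F : Finset ℕ, F.card ≤ t ∧ ∀ k ∉ F, s'.arr a k = s.arr a k := by
  induction h with
  | skip | const | arith | load | loop_done => exact ⟨∅, by simp, fun _ _ => rfl⟩
  | store b i x s =>
    refine ⟨{s.reg i}, by simp, fun k hk => ?_⟩
    rw [Finset.mem_singleton] at hk
    by_cases hab : a = b
    · subst hab
      simp [State.setArr, hk]
    · simp [State.setArr, hab]
  | seq _ _ ihp ihq | loop_step _ _ _ ihp ihq =>
    obtain ⟨F, hF, hF'⟩ := ihp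
    obtain ⟨E, hE, hE'⟩ := ihq
    refine ⟨F ∪ E, (Finset.card_union_le _ _).trans (by omega), fun k hk => ?_⟩
    rw [Finset.notMem_union] at hk
    rw [hE' k hk.2, hF' k hk.1]
  | branch_true _ _ ih | branch_false _ _ ih =>
    obtain ⟨F, hF, hF'⟩ := ih
    exact ⟨F, by omega, hF'⟩

/-- For all-ones factors every entry of the product is `n > 0`, while the output array starts as
zero; so all `n * n` positions change, at most one per step. -/
theorem MultipliesMatricesIn.sq_le {P : Prog} {M : ℕ → ℕ} (h : MultipliesMatricesIn P M) {n : ℕ}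
    (hn : 0 < n) : n * n ≤ M n := by
  obtain ⟨c, h⟩ := h
  obtain ⟨t, s, he, ht, hs⟩ := h n (.of fun _ _ => 1) (.of fun _ _ => 1)
    (by simp) (by simp)
  obtain ⟨F, hF, hF'⟩ := he.exists_changed 2
  have hsub : Finset.range (n * n) ⊆ F := by
    intro k hk
    rw [Finset.mem_range] at hk
    by_contra hkF
    have h₁ := hs ⟨k / n, Nat.div_lt_of_lt_mul hk⟩ ⟨k % n, Nat.mod_lt _ hn⟩
    have h₂ := hF' k hkF
    simp only [Nat.div_add_mod'] at h₁
    rw [h₁] at h₂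
    have h₃ : (mulInput (n := n) (.of fun _ _ => 1) (.of fun _ _ => 1)).arr 2 k = 0 := by
      simp [mulInput]
    rw [h₃, Matrix.mul_apply] at h₂
    simp only [Matrix.of_apply, mul_one, Finset.sum_const, Finset.card_univ,
      Fintype.card_fin, smul_eq_mul] at h₂
    omega
  have := Finset.card_le_card hsub
  rw [Finset.card_range] at this
  omega

/-! ### Relocating a program in memory -/

/-- Rename the registers and the arrays of a program. -/
def Prog.rename (f : ℕ → ℕ) : Prog → Prog
  | .skip => .skip
  | .const x k => .const (f x) k
  | .arith o x y z => .arith o (f x) (f y) (f z)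
  | .load x a i => .load (f x) (f a) (f i)
  | .store a i x => .store (f a) (f i) (f x)
  | .seq p q => .seq (p.rename f) (q.rename f)
  | .branch x p q => .branch (f x) (p.rename f) (q.rename f)
  | .loop x p => .loop (f x) (p.rename f)

/-- The part of the memory that a renamed program sees. -/
def State.view (f : ℕ → ℕ) (s : State) : State where
  reg x := s.reg (f x)
  arr a := s.arr (f a)

theorem Prog.writtenRegs_rename (f : ℕ → ℕ) (p : Prog) :
    (p.rename f).writtenRegs = p.writtenRegs.map f := by
  induction p <;> simp_all [Prog.rename, Prog.writtenRegs]

theorem Prog.writtenArrs_rename (f : ℕ → ℕ) (p : Prog) :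
    (p.rename f).writtenArrs = p.writtenArrs.map f := by
  induction p <;> simp_all [Prog.rename, Prog.writtenArrs]

theorem State.view_setReg {f : ℕ → ℕ} (hf : f.Injective) (s : State) (x k : ℕ) :
    (s.setReg (f x) k).view f = (s.view f).setReg x k := by
  simp only [State.view, State.setReg, State.mk.injEq, and_true]
  exact Function.update_comp_eq_of_injective s.reg hf x k

theorem State.view_setArr {f : ℕ → ℕ} (hf : f.Injective) (s : State) (a i k : ℕ) :
    (s.setArr (f a) i k).view f = (s.view f).setArr a i k := by
  simp only [State.view, State.setArr, State.mk.injEq, true_and]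
  exact Function.update_comp_eq_of_injective s.arr hf a _

/-- Step-by-step simulation. Injectivity keeps distinct cells distinct, so a write to a renamed cell
is seen through `view` as exactly one write. -/
theorem Exec.rename {f : ℕ → ℕ} (hf : f.Injective) (h : Exec B p s t s') :
    ∀ S : State, S.view f = s → ∃ S', Exec B (p.rename f) S t S' ∧ S'.view f = s' := by
  induction h with
  | skip s => exact fun S hS => ⟨S, .skip S, hS⟩
  | const x k s h =>
    rintro S rfl
    exact ⟨_, .const _ _ _ h, State.view_setReg hf _ _ _⟩
  | arith o x y z s h =>
    rintro S rfl
    exact ⟨_, .arith o _ _ _ _ h, State.view_setReg hf _ _ _⟩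
  | load x a i s =>
    rintro S rfl
    exact ⟨_, .load _ _ _ _, State.view_setReg hf _ _ _⟩
  | store a i x s =>
    rintro S rfl
    exact ⟨_, .store _ _ _ _, State.view_setArr hf _ _ _ _⟩
  | seq _ _ ihp ihq =>
    intro S hS
    obtain ⟨S₁, h₁, hS₁⟩ := ihp S hS
    obtain ⟨S₂, h₂, hS₂⟩ := ihq S₁ hS₁
    exact ⟨S₂, .seq h₁ h₂, hS₂⟩
  | branch_true hx _ ih =>
    rintro S rfl
    obtain ⟨S₁, h₁, hS₁⟩ := ih S rfl
    exact ⟨S₁, .branch_true hx h₁, hS₁⟩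
  | branch_false hx _ ih =>
    rintro S rfl
    obtain ⟨S₁, h₁, hS₁⟩ := ih S rfl
    exact ⟨S₁, .branch_false hx h₁, hS₁⟩
  | loop_done hx =>
    rintro S rfl
    exact ⟨S, .loop_done hx, rfl⟩
  | loop_step hx _ _ ihp ihl =>
    rintro S rfl
    obtain ⟨S₁, h₁, hS₁⟩ := ihp S rfl
    obtain ⟨S₂, h₂, hS₂⟩ := ihl S₁ hS₁
    exact ⟨S₂, .loop_step hx h₁ h₂, hS₂⟩

/-! ### Verification of loop-free programs -/

/-- The weakest precondition of a program without loops. -/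
def Prog.wp (B : ℕ) : Prog → (State → Prop) → State → Prop
  | .skip, Q, s => Q s
  | .const x k, Q, s => k < B ∧ Q (s.setReg x k)
  | .arith o x y z, Q, s =>
      o.eval (s.reg y) (s.reg z) < B ∧ Q (s.setReg x (o.eval (s.reg y) (s.reg z)))
  | .load x a i, Q, s => Q (s.setReg x (s.arr a (s.reg i)))
  | .store a i x, Q, s => Q (s.setArr a (s.reg i) (s.reg x))
  | .seq p q, Q, s => p.wp B (q.wp B Q) s
  | .branch x p q, Q, s => (s.reg x ≠ 0 → p.wp B Q s) ∧ (s.reg x = 0 → q.wp B Q s)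
  | .loop _ _, _, _ => False

/-- A bound for the running time of a program without loops. -/
def Prog.cost : Prog → ℕ
  | .seq p q => p.cost + q.cost
  | .branch _ p q => p.cost + q.cost + 1
  | _ => 1

theorem Prog.wp.exec : ∀ {p : Prog} {Q : State → Prop} {s : State}, p.wp B Q s →
    ∃ t s', Exec B p s t s' ∧ t ≤ p.cost ∧ Q s'
  | .skip, _, s, h => ⟨1, s, .skip s, le_rfl, h⟩
  | .const _ _, _, _, h => ⟨1, _, .const _ _ _ h.1, le_rfl, h.2⟩
  | .arith _ _ _ _, _, _, h => ⟨1, _, .arith _ _ _ _ _ h.1, le_rfl, h.2⟩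
  | .load _ _ _, _, _, h => ⟨1, _, .load _ _ _ _, le_rfl, h⟩
  | .store _ _ _, _, _, h => ⟨1, _, .store _ _ _ _, le_rfl, h⟩
  | .seq p q, _, _, h => by
      obtain ⟨t, s₁, h₁, ht, h⟩ := Prog.wp.exec (p := p) h
      obtain ⟨u, s₂, h₂, hu, h⟩ := Prog.wp.exec (p := q) h
      exact ⟨_, s₂, .seq h₁ h₂, Nat.add_le_add ht hu, h⟩
  | .branch x p q, _, s, h => by
      by_cases hx : s.reg x = 0
      · obtain ⟨t, s₁, h₁, ht, h⟩ := Prog.wp.exec (h.2 hx)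
        exact ⟨_, s₁, .branch_false hx h₁, by simp only [Prog.cost]; omega, h⟩
      · obtain ⟨t, s₁, h₁, ht, h⟩ := Prog.wp.exec (h.1 hx)
        exact ⟨_, s₁, .branch_true hx h₁, by simp only [Prog.cost]; omega, h⟩
  | .loop _ _, _, _, h => h.elim

theorem Prog.wp.imp {Q Q' : State → Prop} (hQ : ∀ s, Q s → Q' s) :
    ∀ {p : Prog} {s : State}, p.wp B Q s → p.wp B Q' s
  | .skip, _, h => hQ _ h
  | .const _ _, _, h => ⟨h.1, hQ _ h.2⟩
  | .arith _ _ _ _, _, h => ⟨h.1, hQ _ h.2⟩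
  | .load _ _ _, _, h => hQ _ h
  | .store _ _ _, _, h => hQ _ h
  | .seq p q, _, h =>
      Prog.wp.imp (p := p) (fun _ h' => Prog.wp.imp (p := q) hQ h') h
  | .branch _ _ _, _, h => ⟨fun hx => Prog.wp.imp hQ (h.1 hx), fun hx => Prog.wp.imp hQ (h.2 hx)⟩
  | .loop _ _, _, h => h.elim

/-! ### Loops over the positions of a matrix -/

/-- One round of a loop over the positions of an `n × n` matrix, where register `0` holds `n`,
register `2` holds `1`, register `3` holds `n * n`, and register `4` holds the number of the
remaining rounds: `body` finds the position, its row and its column in the registers `5`, `6`, `7`. -/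
def Prog.gridRound (body : Prog) : Prog :=
  .seq (.arith .sub 5 3 4) (.seq (.arith .sub 4 4 2) (.seq (.arith .div 6 5 0)
    (.seq (.arith .mod 7 5 0) body)))

/-- Run `body` for all positions of an `n × n` matrix, row by row. -/
def Prog.forGrid (body : Prog) : Prog :=
  .seq (.const 2 1) (.seq (.arith .mul 3 0 0) (.seq (.arith .mul 4 0 0)
    (.loop 4 body.gridRound)))

/-- A property of states that does not depend on the registers that control a grid loop. -/
def IgnoresControl (I : State → Prop) : Prop :=
  ∀ s s' : State, (∀ x, x < 2 ∨ 8 ≤ x → s'.reg x = s.reg x) → s'.arr = s.arr → I s → I s'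

/-- Induction on the number `r` of remaining rounds. The body leaves the control registers alone,
and the invariant ignores what the round header does to them. Each round costs the body, four header
instructions and one loop test. -/
theorem exec_loop_gridRound {n : ℕ} (hn : 0 < n) (hB : n * n + 1 < B) {body : Prog}
    (hw : ∀ x ∈ body.writtenRegs, 8 ≤ x) {I : ℕ → State → Prop}
    (hI : ∀ k, IgnoresControl (I k))
    (hbody : ∀ k < n * n, ∀ s, I k s → s.reg 0 = n → s.reg 2 = 1 → s.reg 5 = k →
      s.reg 6 = k / n → s.reg 7 = k % n → body.wp B (I (k + 1)) s) :
    ∀ (r : ℕ) (s : State), r ≤ n * n → s.reg 0 = n → s.reg 2 = 1 → s.reg 3 = n * n →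
      s.reg 4 = r → I (n * n - r) s →
      ∃ t s', Exec B (.loop 4 body.gridRound) s t s' ∧ t ≤ r * (body.cost + 5) + 1 ∧
        I (n * n) s'
  | 0, s, _, _, _, _, h₄, h => ⟨1, s, .loop_done h₄, by simp, h⟩
  | r + 1, s, hr, h₀, h₂, h₃, h₄, h => by
      have hk : n * n - (r + 1) < n * n := by omega
      set k := n * n - (r + 1) with hkdef
      let s₀ : State := (((s.setReg 5 k).setReg 4 r).setReg 6 (k / n)).setReg 7 (k % n)
      have hI₀ : I k s₀ := by
        refine hI _ s s₀ (fun x hx => ?_) rfl h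
        have : x ≠ 4 ∧ x ≠ 5 ∧ x ≠ 6 ∧ x ≠ 7 := by omega
        simp [s₀, State.setReg, this]
      obtain ⟨t, s₁, h₁, ht, hs₁⟩ := (hbody k hk s₀ hI₀ (by simp [s₀, State.setReg, h₀])
        (by simp [s₀, State.setReg, h₂]) (by simp [s₀, State.setReg])
        (by simp [s₀, State.setReg]) (by simp [s₀, State.setReg])).exec
      have hround : Exec B body.gridRound s (1 + (1 + (1 + (1 + t)))) s₁ := by
        have e₁ : Exec B (.arith .sub 5 3 4) s 1 (s.setReg 5 k) := by
          convert Exec.arith (B := B) .sub 5 3 4 s ?_ using 2 <;>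
            simp only [Op.eval, h₃, h₄, ← hkdef]
          omega
        have e₂ : Exec B (.arith .sub 4 4 2) (s.setReg 5 k) 1 ((s.setReg 5 k).setReg 4 r) := by
          convert Exec.arith (B := B) .sub 4 4 2 (s.setReg 5 k) ?_ using 2 <;>
            simp [Op.eval, State.setReg, h₂, h₄]
          omega
        have e₃ : Exec B (.arith .div 6 5 0) ((s.setReg 5 k).setReg 4 r) 1
            (((s.setReg 5 k).setReg 4 r).setReg 6 (k / n)) := by
          convert Exec.arith (B := B) .div 6 5 0 ((s.setReg 5 k).setReg 4 r) ?_ using 2 <;>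
            simp [Op.eval, State.setReg, h₀]
          exact (Nat.div_le_self _ _).trans_lt (by omega)
        have e₄ : Exec B (.arith .mod 7 5 0) (((s.setReg 5 k).setReg 4 r).setReg 6 (k / n)) 1
            s₀ := by
          convert Exec.arith (B := B) .mod 7 5 0
            (((s.setReg 5 k).setReg 4 r).setReg 6 (k / n)) ?_ using 2 <;>
            simp [Op.eval, State.setReg, h₀]
          exact (Nat.mod_le _ _).trans_lt (by omega)
        exact .seq e₁ (.seq e₂ (.seq e₃ (.seq e₄ h₁)))
      have hfr : ∀ x < 8, s₁.reg x = s₀.reg x := fun x hx =>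
        h₁.reg_eq fun hx' => absurd (hw x hx') (by omega)
      obtain ⟨u, s₂, h₂', hu, hs₂⟩ := exec_loop_gridRound hn hB hw hI hbody r s₁ (by omega)
        ((hfr 0 (by simp)).trans (by simp [s₀, State.setReg, h₀]))
        ((hfr 2 (by simp)).trans (by simp [s₀, State.setReg, h₂]))
        ((hfr 3 (by simp)).trans (by simp [s₀, State.setReg, h₃]))
        ((hfr 4 (by simp)).trans (by simp [s₀, State.setReg]))
        (by rwa [show n * n - r = n * n - (r + 1) + 1 by omega])
      refine ⟨_, s₂, .loop_step (by omega) hround h₂', ?_, hs₂⟩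
      rw [Nat.add_mul]
      omega

theorem exec_forGrid {n : ℕ} (hn : 0 < n) (hB : n * n + 1 < B) {body : Prog}
    (hw : ∀ x ∈ body.writtenRegs, 8 ≤ x) {I : ℕ → State → Prop}
    (hI : ∀ k, IgnoresControl (I k))
    (hbody : ∀ k < n * n, ∀ s, I k s → s.reg 0 = n → s.reg 2 = 1 → s.reg 5 = k →
      s.reg 6 = k / n → s.reg 7 = k % n → body.wp B (I (k + 1)) s)
    {s : State} (h₀ : s.reg 0 = n) (h : I 0 s) :
    ∃ t s', Exec B body.forGrid s t s' ∧ t ≤ n * n * (body.cost + 5) + 4 ∧ I (n * n) s' := by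
  let s₀ : State := ((s.setReg 2 1).setReg 3 (n * n)).setReg 4 (n * n)
  have hI₀ : I 0 s₀ := by
    refine hI _ s s₀ (fun x hx => ?_) rfl h
    have : x ≠ 2 ∧ x ≠ 3 ∧ x ≠ 4 := by omega
    simp [s₀, State.setReg, this]
  obtain ⟨t, s', he, ht, hs'⟩ := exec_loop_gridRound hn hB hw hI hbody (n * n) s₀ le_rfl
    (by simp [s₀, State.setReg, h₀]) (by simp [s₀, State.setReg]) (by simp [s₀, State.setReg])
    (by simp [s₀, State.setReg]) (by rwa [Nat.sub_self])
  have e₁ : Exec B (.const 2 1) s 1 (s.setReg 2 1) := .const _ _ _ (by omega)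
  have e₂ : Exec B (.arith .mul 3 0 0) (s.setReg 2 1) 1 ((s.setReg 2 1).setReg 3 (n * n)) := by
    convert Exec.arith (B := B) .mul 3 0 0 (s.setReg 2 1) ?_ using 2 <;>
      simp [Op.eval, State.setReg, h₀]
    omega
  have e₃ : Exec B (.arith .mul 4 0 0) ((s.setReg 2 1).setReg 3 (n * n)) 1 s₀ := by
    convert Exec.arith (B := B) .mul 4 0 0 ((s.setReg 2 1).setReg 3 (n * n)) ?_ using 2 <;>
      simp [Op.eval, State.setReg, h₀]
    omega
  exact ⟨_, s', .seq e₁ (.seq e₂ (.seq e₃ he)), by omega, hs'⟩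

end SquareRoot

namespace SquareRoot

/-! ### The search for the root -/

/-- Adjacency of vertices that are given by natural numbers. -/
def NatAdj {n : ℕ} (H : SimpleGraph (Fin n)) (i j : ℕ) : Prop :=
  ∃ (hi : i < n) (hj : j < n), H.Adj ⟨i, hi⟩ ⟨j, hj⟩

theorem index_lt {n i j : ℕ} (hi : i < n) (hj : j < n) : i * n + j < n * n := by
  have := Nat.mul_le_mul_right n (Nat.succ_le_of_lt hi)
  rw [Nat.succ_mul] at this
  omega

theorem index_inj {n i j i' j' : ℕ} (hj : j < n) (hj' : j' < n)
    (h : i * n + j = i' * n + j') : i = i' ∧ j = j' := by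
  have hn : 0 < n := by omega
  have h₁ := congrArg (· / n) h
  have h₂ := congrArg (· % n) h
  simp only [Nat.mul_add_mod_self_right, Nat.mod_eq_of_lt hj, Nat.mod_eq_of_lt hj'] at h₂
  simp only [mul_comm _ n, Nat.mul_add_div hn, Nat.div_eq_of_lt hj, Nat.div_eq_of_lt hj',
    add_zero] at h₁
  exact ⟨h₁, h₂⟩

theorem matrixArray_index {n : ℕ} (A : Matrix (Fin n) (Fin n) ℕ) (i j : Fin n) :
    matrixArray A (i * n + j) = A i j := by
  have hn : 0 < n := i.pos
  have h₁ : ((i : ℕ) * n + j) / n = i := by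
    rw [mul_comm, Nat.mul_add_div hn, Nat.div_eq_of_lt j.2, add_zero]
  have h₂ : ((i : ℕ) * n + j) % n = j := by
    rw [Nat.mul_add_mod_self_right, Nat.mod_eq_of_lt j.2]
  unfold matrixArray
  rw [dif_pos (index_lt i.2 j.2)]
  congr 1 <;> exact Fin.ext (by assumption)

open Classical in
theorem matrixArray_adjacency {n : ℕ} (G : SimpleGraph (Fin n)) {i j : ℕ} (hi : i < n)
    (hj : j < n) : matrixArray (adjacency G) (i * n + j) = if NatAdj G i j then 1 else 0 := by
  rw [matrixArray_index _ ⟨i, hi⟩ ⟨j, hj⟩]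
  simp [adjacency, NatAdj, hi, hj]

open Classical in
theorem setArray_neighborSet {n : ℕ} (H : SimpleGraph (Fin n)) (v : Fin n) (w : ℕ) :
    setArray (H.neighborSet v) w = if NatAdj H v w then 1 else 0 := by
  have : (∃ u ∈ H.neighborSet v, (u : ℕ) = w) ↔ NatAdj H v w := by
    constructor
    · rintro ⟨u, hu, rfl⟩
      exact ⟨v.2, u.2, hu⟩
    · rintro ⟨_, hw, h⟩
      exact ⟨⟨w, hw⟩, h, rfl⟩
  simp only [setArray, this]

theorem setArray_eq_zero_or_one {n : ℕ} (U : Set (Fin n)) (k : ℕ) :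
    setArray U k = 0 ∨ setArray U k = 1 := by
  unfold setArray
  split_ifs <;> simp

theorem matrixArray_adjacency_eq_zero_or_one {n : ℕ} (G : SimpleGraph (Fin n)) (k : ℕ) :
    matrixArray (adjacency G) k = 0 ∨ matrixArray (adjacency G) k = 1 := by
  unfold matrixArray adjacency
  split_ifs <;> simp

/-- The neighborhood formula of `neighborSet_eq_of_adj`, in terms of array indices. -/
theorem natAdj_iff_of_natAdj {n : ℕ} {H : SimpleGraph (Fin n)} (hH : C3C5Free H) {x y w : ℕ}
    (hw : w < n) (hxy : NatAdj H x y) :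
    NatAdj H y w ↔ NatAdj (power H 2) y w ∧ (x = w ∨ NatAdj (power H 2) x w) ∧
      ¬ NatAdj H x w := by
  obtain ⟨hx, hy, hxy⟩ := hxy
  have := Set.ext_iff.1 (neighborSet_eq_of_adj hH hxy) ⟨w, hw⟩
  simp only [SimpleGraph.mem_neighborSet, Set.mem_inter_iff, Set.mem_sdiff, Set.mem_insert_iff,
    Fin.mk.injEq] at this
  simp [NatAdj, hx, hy, hw, this, eq_comm]

open Classical in
/-- The memory of the search for a graph with adjacency relation `adj` after `k` rounds: `tail`
vertices have been put into the queue `q` and have been marked in `m`; `par` holds the vertex from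
which a vertex was found; the rounds done so far filled the rows of the matrix `A` in the order of
the queue. -/
structure SearchCorrect (n v : ℕ) (adj : ℕ → ℕ → Prop) (k tail : ℕ) (q m par A : ℕ → ℕ) :
    Prop where
  mark : ∀ z, m z ≠ 0 ↔ ∃ i < tail, q i = z
  tail_pos : 0 < tail
  start : q 0 = v
  inj : ∀ i j, i < j → j < tail → q i ≠ q j
  parent : ∀ i, 0 < i → i < tail → ∃ j < i, par (q i) = q j ∧ adj (q j) (q i)
  row : ∀ i < tail, ∀ w < n, i * n + w < k → A (q i * n + w) = if adj (q i) w then 1 else 0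
  closed : ∀ i < tail, ∀ w < n, i * n + w < k → adj (q i) w → m w ≠ 0

namespace SearchCorrect

variable {n : ℕ} {v : Fin n} {H : SimpleGraph (Fin n)} {k tail : ℕ} {q m par A : ℕ → ℕ}

/-- Once the rows of all queued vertices are complete, the queued set contains `v` and is closed
under adjacency, so connectivity makes it everything. -/
theorem exists_index_of_le (h : SearchCorrect n v (NatAdj H) k tail q m par A)
    (hG : (power H 2).Connected) {b : ℕ} (hb : b * n ≤ k) (htb : tail ≤ b) (z : Fin n) :
    ∃ i < tail, q i = z := by
  refine forall_of_power_two_connected hG (S := fun z : Fin n => ∃ i < tail, q i = z) (v := v)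
    ⟨0, h.tail_pos, h.start⟩ ?_ z
  rintro x y ⟨i, hi, hx⟩ hxy
  refine (h.mark y).1 (h.closed i hi y y.2 ?_ ?_)
  · have := Nat.mul_le_mul_right n (show i + 1 ≤ b by omega)
    rw [Nat.succ_mul] at this
    have := y.2
    omega
  · rw [hx]
    exact ⟨x.2, y.2, hxy⟩

theorem le_of_forall_exists_index (h : ∀ z : Fin n, ∃ i < tail, q i = z) : n ≤ tail := by
  choose f hf hf' using h
  have hinj : Function.Injective f := fun a b hab => Fin.ext (by rw [← hf' a, ← hf' b, hab])
  have := Finset.card_le_card_of_injOn (s := Finset.univ) (t := Finset.range tail) f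
    (fun z _ => by simpa using hf z) hinj.injOn
  simpa using this

/-- The queue never runs dry: otherwise all `n` vertices would already be in it, giving `n ≤ tail ≤
k / n < n`. Hence a fixed count of `n * n` rounds needs no test for an empty queue. -/
theorem div_lt_tail (h : SearchCorrect n v (NatAdj H) k tail q m par A)
    (hG : (power H 2).Connected) (hk : k < n * n) : k / n < tail := by
  by_contra hlt
  have h₁ := le_of_forall_exists_index
    (h.exists_index_of_le hG (Nat.div_mul_le_self k n) (by omega))
  have h₂ := Nat.div_lt_of_lt_mul hk
  omega

theorem tail_le (h : SearchCorrect n v (NatAdj H) k tail q m par A) (hq : ∀ i, q i < n) :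
    tail ≤ n := by
  have := Finset.card_le_card_of_injOn (s := Finset.range tail) (t := Finset.range n) q
    (fun i _ => by simpa using hq i) (fun i hi j hj hij => by
      simp only [Finset.coe_range, Set.mem_Iio] at hi hj
      rcases lt_trichotomy i j with hlt | rfl | hlt
      · exact absurd hij (h.inj _ _ hlt hj)
      · rfl
      · exact absurd hij.symm (h.inj _ _ hlt hi))
  simpa using this

open Classical in
theorem final (h : SearchCorrect n v (NatAdj H) (n * n) tail q m par A)
    (hG : (power H 2).Connected) (hq : ∀ i, q i < n) (x y : Fin n) :
    A (x * n + y) = if H.Adj x y then 1 else 0 := by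
  obtain ⟨i, hi, hx⟩ := h.exists_index_of_le hG le_rfl (h.tail_le hq) x
  have := h.row i hi y y.2 (index_lt (hi.trans_le (h.tail_le hq)) y.2)
  rw [hx] at this
  rw [this]
  simp [NatAdj]

open Classical in
/-- The entry that round `k` computes. -/
theorem entry_eq (h : SearchCorrect n v (NatAdj H) k tail q m par A)
    (hG : (power H 2).Connected) (hH : C3C5Free H) (hk : k < n * n) (hq : ∀ i, q i < n) :
    (if k / n = 0 then setArray (H.neighborSet v) (k % n)
      else if A (par (q (k / n)) * n + k % n) = 0 then
        matrixArray (adjacency (power H 2)) (q (k / n) * n + k % n) *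
          (if par (q (k / n)) = k % n then 1
            else matrixArray (adjacency (power H 2)) (par (q (k / n)) * n + k % n))
      else 0) = if NatAdj H (q (k / n)) (k % n) then 1 else 0 := by
  have hw : k % n < n := Nat.mod_lt _ v.pos
  have hkn := Nat.div_add_mod' k n
  have htail := h.div_lt_tail hG hk
  generalize k % n = w at *
  generalize k / n = b at *
  by_cases hb : b = 0
  · rw [if_pos hb, hb, h.start, setArray_neighborSet]
  · obtain ⟨j, hj, hpar, hadj⟩ := h.parent b (Nat.pos_of_ne_zero hb) htail
    -- The parent stands earlier in the queue, so its whole row is already filled.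
    have hrow := h.row j (hj.trans htail) w hw (by
      have := Nat.mul_le_mul_right n (Nat.succ_le_of_lt hj)
      rw [Nat.succ_mul] at this
      omega)
    have hiff := natAdj_iff_of_natAdj hH hw hadj
    rw [if_neg hb, hpar, hrow, matrixArray_adjacency _ (hq _) hw,
      matrixArray_adjacency _ (hq _) hw]
    by_cases h₁ : NatAdj H (q j) w <;> by_cases h₂ : q j = w <;>
      by_cases h₃ : NatAdj (power H 2) (q b) w <;> simp [hiff, h₁, h₂, h₃]

open Classical in
theorem write (h : SearchCorrect n v (NatAdj H) k tail q m par A)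
    (hG : (power H 2).Connected) (hk : k < n * n)
    (hm : NatAdj H (q (k / n)) (k % n) → m (k % n) ≠ 0) :
    SearchCorrect n v (NatAdj H) (k + 1) tail q m par
      (Function.update A (q (k / n) * n + k % n)
        (if NatAdj H (q (k / n)) (k % n) then 1 else 0)) := by
  have hw : k % n < n := Nat.mod_lt _ v.pos
  have hkn := Nat.div_add_mod' k n
  have htail := h.div_lt_tail hG hk
  generalize k % n = w at *
  generalize k / n = b at *
  refine { h with row := fun i hi w' hw' hlt => ?_, closed := fun i hi w' hw' hlt hadj => ?_ }
  · by_cases heq : q i * n + w' = q b * n + w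
    · obtain ⟨h₁, rfl⟩ := index_inj hw' hw heq
      rw [heq, Function.update_self, h₁]
    · rw [Function.update_of_ne heq]
      -- Time `i * n + w'` follows queue order, whereas the matrix position uses the vertex `q i`;
      -- an entry due at time `k` is the one just written.
      refine h.row i hi w' hw' ((Nat.lt_succ_iff_lt_or_eq.1 hlt).resolve_right fun hik => ?_)
      obtain ⟨rfl, rfl⟩ := index_inj hw' hw (hik.trans hkn.symm)
      exact heq rfl
  · rcases Nat.lt_succ_iff_lt_or_eq.1 hlt with hlt | hik
    · exact h.closed i hi w' hw' hlt hadj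
    · obtain ⟨rfl, rfl⟩ := index_inj hw' hw (hik.trans hkn.symm)
      exact hm hadj

theorem push (h : SearchCorrect n v (NatAdj H) k tail q m par A)
    (hG : (power H 2).Connected) (hk : k < n * n)
    (hm : m (k % n) = 0) (hadj : NatAdj H (q (k / n)) (k % n)) :
    SearchCorrect n v (NatAdj H) k (tail + 1) (Function.update q tail (k % n))
      (Function.update m (k % n) 1) (Function.update par (k % n) (q (k / n))) A := by
  have hkn := Nat.div_add_mod' k n
  have hw : k % n < n := Nat.mod_lt _ v.pos
  have htail := h.div_lt_tail hG hk
  generalize k % n = w at *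
  generalize k / n = b at *
  have hne : ∀ i < tail, q i ≠ w := fun i hi hi' => (h.mark w).2 ⟨i, hi, hi'⟩ hm
  have hq : ∀ i < tail, Function.update q tail w i = q i := fun i hi =>
    Function.update_of_ne hi.ne _ _
  -- The new queue position exceeds the current row number `b`, so nothing is yet claimed about its
  -- row.
  have hold : ∀ i < tail + 1, ∀ w', i * n + w' < k → i < tail := fun i hi w' hlt => by
    refine (Nat.lt_succ_iff_lt_or_eq.1 hi).resolve_right fun hi' => ?_
    have := Nat.mul_le_mul_right n (show b + 1 ≤ i by omega)
    rw [Nat.succ_mul] at this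
    omega
  constructor
  · intro z
    by_cases hz : z = w
    · subst hz
      simp only [Function.update_self, ne_eq, one_ne_zero, not_false_eq_true, true_iff]
      exact ⟨tail, by omega, Function.update_self _ _ _⟩
    · rw [Function.update_of_ne hz, h.mark]
      constructor
      · rintro ⟨i, hi, hi'⟩
        exact ⟨i, by omega, (hq i hi).trans hi'⟩
      · rintro ⟨i, hi, hi'⟩
        rcases Nat.lt_succ_iff_lt_or_eq.1 hi with hi | rfl
        · exact ⟨i, hi, (hq i hi).symm.trans hi'⟩
        · rw [Function.update_self] at hi'
          exact absurd hi'.symm hz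
  · omega
  · rw [hq 0 h.tail_pos, h.start]
  · intro i j hij hj
    rcases Nat.lt_succ_iff_lt_or_eq.1 hj with hj | rfl
    · rw [hq i (by omega), hq j hj]
      exact h.inj i j hij hj
    · rw [hq i hij, Function.update_self]
      exact hne i hij
  · intro i hi hi'
    rcases Nat.lt_succ_iff_lt_or_eq.1 hi' with hi' | rfl
    · obtain ⟨j, hj, h₁, h₂⟩ := h.parent i hi hi'
      refine ⟨j, hj, ?_⟩
      rw [hq i hi', hq j (by omega), Function.update_of_ne (hne i hi')]
      exact ⟨h₁, h₂⟩
    · refine ⟨b, htail, ?_⟩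
      rw [hq b htail, Function.update_self, Function.update_self]
      exact ⟨rfl, hadj⟩
  · intro i hi w' hw' hlt
    rw [hq i (hold i hi w' hlt)]
    exact h.row i (hold i hi w' hlt) w' hw' hlt
  · intro i hi w' hw' hlt hadj'
    have hi := hold i hi w' hlt
    rw [hq i hi] at hadj'
    have := h.closed i hi w' hw' hlt hadj'
    rw [Function.update_of_ne (show w' ≠ w from fun h' => this (by rw [h', hm]))]
    exact this

theorem initial (v : ℕ) (adj : ℕ → ℕ → Prop) :
    SearchCorrect n v adj 0 1 (Function.update (fun _ => 0) 0 v)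
      (Function.update (fun _ => 0) v 1) par A := by
  constructor
  · intro z
    by_cases hz : z = v
    · subst hz
      simp
    · simp [hz, Ne.symm hz]
  · exact one_pos
  · simp
  · omega
  · omega
  · omega
  · omega

end SearchCorrect

end SquareRoot

namespace SquareRoot

/-! ### The program -/

/-- Compute entry `j` (register `7`) of the row of the vertex at position `i` (register `6`) of the
queue: it goes to register `13`, the vertex to register `9` and the position of the entry in the
matrix to register `10`. The graph is in array `0`, the given neighborhood in array `1`, the root in
array `2`, the queue in array `3`, the marks in array `4` and the parents in array `5`. -/
def searchEntry : Prog :=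
  .seq (.load 9 3 6) <| .seq (.arith .mul 10 9 0) <| .seq (.arith .add 10 10 7) <|
  .branch 6
    (.seq (.load 11 5 9) <| .seq (.arith .mul 12 11 0) <| .seq (.arith .add 12 12 7) <|
      .seq (.load 13 2 12) <|
      .branch 13 (.const 13 0) <|
        .seq (.load 14 0 12) <| .seq (.arith .sub 15 11 7) <| .seq (.arith .sub 16 7 11) <|
        .seq (.arith .add 15 15 16) <| .seq (.branch 15 .skip (.const 14 1)) <|
        .seq (.load 13 0 10) (.arith .mul 13 13 14))
    (.load 13 1 7)

/-- Write the computed entry to the matrix and to the input of the first multiplication, and put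
the vertex `j` into the queue if it is a new neighbor. Register `8` holds the end of the queue. -/
def searchRecord : Prog :=
  .seq (.store 2 10 13) <| .seq (.store 100 10 13) <| .seq (.store 102 10 13) <|
  .branch 13
    (.seq (.load 14 4 7) <| .branch 14 .skip <|
      .seq (.store 4 7 2) <| .seq (.store 5 7 9) <| .seq (.store 3 8 7) (.arith .add 8 8 2))
    .skip

/-- The value computed by `searchEntry`. -/
def searchValue (n : ℕ) (g u A q par : ℕ → ℕ) (i j : ℕ) : ℕ :=
  if i = 0 then u j
  else if A (par (q i) * n + j) = 0 then
    g (q i * n + j) * (if par (q i) = j then 1 else g (par (q i) * n + j))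
  else 0

theorem wp_searchEntry {B n i j : ℕ} {s : State} (hB : n * n + 1 < B) (hj : j < n)
    (h₀ : s.reg 0 = n) (h₆ : s.reg 6 = i) (h₇ : s.reg 7 = j)
    (hg : ∀ k, s.arr 0 k = 0 ∨ s.arr 0 k = 1)
    (hq : ∀ k, s.arr 3 k < n) (hpar : ∀ k, s.arr 5 k < n) :
    searchEntry.wp B (fun s' => s'.arr = s.arr ∧ (∀ x ≤ 8, s'.reg x = s.reg x) ∧
      s'.reg 9 = s.arr 3 i ∧ s'.reg 10 = s.arr 3 i * n + j ∧
      s'.reg 13 = searchValue n (s.arr 0) (s.arr 1) (s.arr 2) (s.arr 3) (s.arr 5) i j) s := by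
  have hnB : n < B := by nlinarith
  have b₁ := index_lt (hq i) hj
  have b₂ := index_lt (hpar (s.arr 3 i)) hj
  have hne : ∀ x ≤ 8, x ≠ 9 ∧ x ≠ 10 ∧ x ≠ 11 ∧ x ≠ 12 ∧ x ≠ 13 ∧ x ≠ 14 ∧ x ≠ 15 ∧ x ≠ 16 := by
    omega
  have hp := hpar (s.arr 3 i)
  have g₁ := hg (s.arr 3 i * n + j)
  have g₂ := hg (s.arr 5 (s.arr 3 i) * n + j)
  simp +contextual [searchEntry, Prog.wp, Op.eval, State.setReg, h₀, h₆, h₇, hne, searchValue]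
  refine ⟨by omega, by omega, fun _ => ⟨by omega, by omega, fun _ => by omega, fun _ =>
    ⟨by omega, by omega, by omega, fun h => ⟨?_, fun h' => by omega⟩,
      fun h h' => ⟨by omega, by omega, fun h'' => by omega⟩⟩⟩⟩
  -- What remains is the word bound for the product, whose factors are 0 or 1.
  rcases g₁ with g₁ | g₁ <;> rcases g₂ with g₂ | g₂ <;> rw [g₁, g₂] <;> omega

theorem wp_searchRecord {B j : ℕ} {s : State} (hB : s.reg 8 + 1 < B)
    (h₂ : s.reg 2 = 1) (h₇ : s.reg 7 = j) :
    searchRecord.wp B (fun s' => (∀ x < 8, s'.reg x = s.reg x) ∧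
      s'.arr 0 = s.arr 0 ∧ s'.arr 1 = s.arr 1 ∧
      s'.arr 2 = Function.update (s.arr 2) (s.reg 10) (s.reg 13) ∧
      s'.arr 100 = Function.update (s.arr 100) (s.reg 10) (s.reg 13) ∧
      s'.arr 102 = Function.update (s.arr 102) (s.reg 10) (s.reg 13) ∧
      ((s.reg 13 ≠ 0 ∧ s.arr 4 j = 0 ∧ s'.reg 8 = s.reg 8 + 1 ∧
          s'.arr 3 = Function.update (s.arr 3) (s.reg 8) j ∧
          s'.arr 4 = Function.update (s.arr 4) j 1 ∧
          s'.arr 5 = Function.update (s.arr 5) j (s.reg 9)) ∨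
        ((s.reg 13 ≠ 0 → s.arr 4 j ≠ 0) ∧ s'.reg 8 = s.reg 8 ∧ s'.arr 3 = s.arr 3 ∧
          s'.arr 4 = s.arr 4 ∧ s'.arr 5 = s.arr 5))) s := by
  have hne : ∀ x < 8, x ≠ 8 ∧ x ≠ 14 := by omega
  simp +contextual [searchRecord, Prog.wp, Op.eval, State.setReg, State.setArr, h₂, h₇, hne, hB]

/-- One round of the search. -/
def searchBody : Prog := .seq searchEntry searchRecord

/-- The state of the search after `k` rounds. -/
structure SearchInv {n : ℕ} (G : SimpleGraph (Fin n)) (v : Fin n) (U : Set (Fin n)) (k : ℕ)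
    (s : State) : Prop where
  reg_zero : s.reg 0 = n
  reg_one : s.reg 1 = v
  graph : s.arr 0 = matrixArray (adjacency G)
  nbhd : s.arr 1 = setArray U
  left : s.arr 100 = s.arr 2
  right : s.arr 102 = s.arr 2
  entry : ∀ i, s.arr 2 i = 0 ∨ s.arr 2 i = 1
  outside : ∀ i, n * n ≤ i → s.arr 2 i = 0
  queue : ∀ i, s.arr 3 i < n
  parent : ∀ i, s.arr 5 i < n
  tail : s.reg 8 ≤ k + 1
  correct : ∀ H, IsRootWithNbhd G v U H →
    SearchCorrect n v (NatAdj H) k (s.reg 8) (s.arr 3) (s.arr 4) (s.arr 5) (s.arr 2)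

theorem searchValue_eq_zero_or_one {n : ℕ} {g u A q par : ℕ → ℕ} (hg : ∀ k, g k = 0 ∨ g k = 1)
    (hu : ∀ k, u k = 0 ∨ u k = 1) (i j : ℕ) :
    searchValue n g u A q par i j = 0 ∨ searchValue n g u A q par i j = 1 := by
  unfold searchValue
  have := hu j
  have h₁ := hg (q i * n + j)
  have h₂ := hg (par (q i) * n + j)
  split_ifs
  · exact this
  · rwa [mul_one]
  · rcases h₁ with h₁ | h₁ <;> simp [h₁, h₂]
  · exact Or.inl rfl

theorem forall_update {α β : Type*} [DecidableEq α] (S : β → Prop) {f : α → β}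
    (hf : ∀ i, S (f i)) {a : α} {b : β} (hb : S b) (i : α) : S (Function.update f a b i) := by
  rw [Function.update_apply]
  split_ifs
  exacts [hb, hf i]

theorem SearchInv.ignoresControl {n : ℕ} (G : SimpleGraph (Fin n)) (v : Fin n) (U : Set (Fin n))
    (k : ℕ) : IgnoresControl (SearchInv G v U k) := by
  intro s s' hr ha h
  have h₀ := hr 0 (by omega)
  have h₁ := hr 1 (by omega)
  have h₈ := hr 8 (by omega)
  constructor <;> (try rw [ha]) <;> first | rw [h₀] | rw [h₁] | rw [h₈] | skip
  exacts [h.1, h.2, h.3, h.4, h.5, h.6, h.7, h.8, h.9, h.10, h.11, h.12]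

open Classical in
-- The range conditions persist whether or not a root exists, so the search runs safely on every
-- instance. Correctness is carried only relative to a hypothetical root, for which `entry_eq`
-- identifies the computed value.
theorem SearchInv.wp_searchBody {n B : ℕ} {G : SimpleGraph (Fin n)} (hG : G.Connected) {v : Fin n}
    {U : Set (Fin n)} (hB : n * n + 1 < B) {k : ℕ} (hk : k < n * n) {s : State}
    (h : SearchInv G v U k s) (h₂ : s.reg 2 = 1) (h₆ : s.reg 6 = k / n) (h₇ : s.reg 7 = k % n) :
    searchBody.wp B (SearchInv G v U (k + 1)) s := by
  have hj : k % n < n := Nat.mod_lt _ v.pos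
  have hg : ∀ i, s.arr 0 i = 0 ∨ s.arr 0 i = 1 := by
    rw [h.graph]
    exact matrixArray_adjacency_eq_zero_or_one G
  have hu : ∀ i, s.arr 1 i = 0 ∨ s.arr 1 i = 1 := by
    rw [h.nbhd]
    exact setArray_eq_zero_or_one U
  refine (wp_searchEntry hB hj h.reg_zero h₆ h₇ hg h.queue h.parent).imp ?_
  rintro s₁ ⟨ha, hr, h₉, h₁₀, h₁₃⟩
  have htail := h.tail
  refine (wp_searchRecord (j := k % n) (by rw [hr 8 le_rfl]; omega)
    ((hr 2 (by omega)).trans h₂) ((hr 7 (by omega)).trans h₇)).imp ?_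
  have hc := searchValue_eq_zero_or_one (n := n) (A := s.arr 2) (q := s.arr 3) (par := s.arr 5)
    hg hu (k / n) (k % n)
  have hval : ∀ H, IsRootWithNbhd G v U H → searchValue n (s.arr 0) (s.arr 1) (s.arr 2) (s.arr 3)
      (s.arr 5) (k / n) (k % n) = if NatAdj H (s.arr 3 (k / n)) (k % n) then 1 else 0 := by
    intro H hH
    have hcor := h.correct H hH
    rw [h.graph, h.nbhd]
    obtain ⟨hfree, rfl, rfl⟩ := hH
    exact hcor.entry_eq hG hfree hk h.queue
  generalize searchValue n (s.arr 0) (s.arr 1) (s.arr 2) (s.arr 3) (s.arr 5) (k / n) (k % n) = c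
    at *
  rintro s₂ ⟨hr₂, a₀, a₁, a₂, a₁₀₀, a₁₀₂, hrec⟩
  rw [ha, h₁₀, h₁₃] at a₂ a₁₀₀ a₁₀₂
  rw [ha, h₉, h₁₃, hr 8 le_rfl] at hrec
  rw [ha] at a₀ a₁
  have hbase : (∀ i, s₂.arr 3 i < n) ∧ (∀ i, s₂.arr 5 i < n) ∧ s₂.reg 8 ≤ k + 1 + 1 := by
    rcases hrec with ⟨-, -, h₈, q₃, -, q₅⟩ | ⟨-, h₈, q₃, -, q₅⟩
    · rw [q₃, q₅, h₈]
      exact ⟨forall_update (· < n) h.queue hj, forall_update (· < n) h.parent (h.queue _),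
        by omega⟩
    · rw [q₃, q₅, h₈]
      exact ⟨h.queue, h.parent, by omega⟩
  refine ⟨?_, ?_, a₀.trans h.graph, a₁.trans h.nbhd, ?_, ?_, ?_, ?_, hbase.1, hbase.2.1,
    hbase.2.2, ?_⟩
  · rw [hr₂ 0 (by omega), hr 0 (by omega), h.reg_zero]
  · rw [hr₂ 1 (by omega), hr 1 (by omega), h.reg_one]
  · rw [a₂, a₁₀₀, h.left]
  · rw [a₂, a₁₀₂, h.right]
  · rw [a₂]
    exact forall_update (fun a => a = 0 ∨ a = 1) h.entry hc
  · intro i hi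
    have := index_lt (h.queue (k / n)) hj
    rw [a₂, Function.update_of_ne (by omega)]
    exact h.outside i hi
  · intro H hH
    have hcor := h.correct H hH
    have hcv := hval H hH
    obtain ⟨-, rfl, -⟩ := hH
    have hlt := hcor.div_lt_tail hG hk
    rcases hrec with ⟨hc₀, hm, h₈, q₃, q₄, q₅⟩ | ⟨hm, h₈, q₃, q₄, q₅⟩
    · have hadj : NatAdj H (s.arr 3 (k / n)) (k % n) := by
        by_contra hadj
        rw [if_neg hadj] at hcv
        exact hc₀ hcv
      -- The program writes before it pushes, but `closed` needs the mark first. The order is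
      -- immaterial: the push changes the queue only at the tail, beyond the position `k / n` that
      -- the write reads.
      have := (hcor.push hG hk hm hadj).write hG hk (fun _ => by simp)
      rw [Function.update_of_ne hlt.ne, ← hcv] at this
      rw [h₈, q₃, q₄, q₅, a₂]
      exact this
    · have := hcor.write hG hk (fun hadj => hm (by rw [hcv, if_pos hadj]; exact one_ne_zero))
      rw [← hcv] at this
      rw [h₈, q₃, q₄, q₅, a₂]
      exact this

/-! ### Computing the support and testing the candidate -/

/-- Replace the nonzero entries of the first product by `1`. -/
def supportBody : Prog :=
  .seq (.load 9 104 5) <| .seq (.branch 9 (.const 9 1) .skip) <|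
  .seq (.store 101 5 9) (.store 103 5 9)

/-- Load the numbers that are tested at one position of the matrix. -/
def testLoad : Prog :=
  .seq (.arith .mul 10 7 0) <| .seq (.arith .add 10 10 6) <|
  .seq (.load 11 2 5) <| .seq (.load 12 2 10) <| .seq (.load 13 0 5) <| .seq (.load 14 104 5) <|
  .seq (.load 15 105 5) <| .seq (.load 16 1 7) <|
  .seq (.arith .sub 17 6 7) <| .seq (.arith .sub 18 7 6) <| .seq (.arith .add 17 17 18) <|
  .seq (.arith .sub 18 6 1) <| .seq (.arith .sub 19 1 6) (.arith .add 18 18 19)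

/-- Test the loaded numbers; register `8` is set to `0` if the test fails. -/
def testDecide : Prog :=
  .branch 11
    (.branch 12 (.branch 17 (.branch 14 (.const 8 0) (.branch 15 (.const 8 0)
      (.branch 13 (.branch 18 .skip (.branch 16 .skip (.const 8 0))) (.const 8 0)))) (.const 8 0))
      (.const 8 0))
    (.branch 12 (.const 8 0) (.seq (.branch 18 .skip (.branch 16 (.const 8 0) .skip))
      (.branch 17 (.branch 13 (.branch 14 .skip (.const 8 0)) (.branch 14 (.const 8 0) .skip))
        .skip)))

/-- The test at one position of the matrix. -/
def testBody : Prog := .seq testLoad testDecide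

/-- The condition that `testBody` tests at row `i` and column `j`. -/
def TestOk (n v : ℕ) (g u A p q : ℕ → ℕ) (i j : ℕ) : Prop :=
  (A (i * n + j) ≠ 0 ↔ A (j * n + i) ≠ 0) ∧
  (A (i * n + j) ≠ 0 → i ≠ j ∧ p (i * n + j) = 0 ∧ q (i * n + j) = 0) ∧
  (i = v → (A (i * n + j) ≠ 0 ↔ u j ≠ 0)) ∧
  (i ≠ j → (g (i * n + j) ≠ 0 ↔ A (i * n + j) ≠ 0 ∨ p (i * n + j) ≠ 0))

theorem wp_supportBody {B : ℕ} {s : State} (hB : 1 < B) :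
    supportBody.wp B (fun s' => (∀ x < 9, s'.reg x = s.reg x) ∧
      (∀ a, a ≠ 101 → a ≠ 103 → s'.arr a = s.arr a) ∧
      s'.arr 101 = Function.update (s.arr 101) (s.reg 5) (if s.arr 104 (s.reg 5) = 0 then 0 else 1) ∧
      s'.arr 103 = Function.update (s.arr 103) (s.reg 5) (if s.arr 104 (s.reg 5) = 0 then 0 else 1))
      s := by
  have hne : ∀ x < 9, x ≠ 9 := by omega
  simp +contextual [supportBody, Prog.wp, State.setReg, State.setArr, hne, hB]

theorem wp_testLoad {B n v i j : ℕ} {s : State} (hB : n * n + 1 < B) (hi : i < n) (hj : j < n)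
    (hv : v < n) (h₀ : s.reg 0 = n) (h₁ : s.reg 1 = v) (h₅ : s.reg 5 = i * n + j)
    (h₆ : s.reg 6 = i) (h₇ : s.reg 7 = j) :
    testLoad.wp B (fun s' => (∀ x ≤ 8, s'.reg x = s.reg x) ∧ s'.arr = s.arr ∧
      s'.reg 11 = s.arr 2 (i * n + j) ∧ s'.reg 12 = s.arr 2 (j * n + i) ∧
      s'.reg 13 = s.arr 0 (i * n + j) ∧ s'.reg 14 = s.arr 104 (i * n + j) ∧
      s'.reg 15 = s.arr 105 (i * n + j) ∧ s'.reg 16 = s.arr 1 j ∧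
      s'.reg 17 = (i - j) + (j - i) ∧ s'.reg 18 = (i - v) + (v - i)) s := by
  have hnB : n < B := by nlinarith
  have b₁ := index_lt hj hi
  have hne : ∀ x ≤ 8, x ≠ 10 ∧ x ≠ 11 ∧ x ≠ 12 ∧ x ≠ 13 ∧ x ≠ 14 ∧ x ≠ 15 ∧ x ≠ 16 ∧
    x ≠ 17 ∧ x ≠ 18 ∧ x ≠ 19 := by
    omega
  simp +contextual [testLoad, Prog.wp, Op.eval, State.setReg, h₀, h₁, h₅, h₆, h₇, hne]
  omega

open Classical in
theorem wp_testDecide {B : ℕ} {s : State} (hB : 0 < B) :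
    testDecide.wp B (fun s' => (∀ x < 8, s'.reg x = s.reg x) ∧ s'.arr = s.arr ∧
      s'.reg 8 = if (s.reg 11 ≠ 0 ↔ s.reg 12 ≠ 0) ∧
          (s.reg 11 ≠ 0 → s.reg 17 ≠ 0 ∧ s.reg 14 = 0 ∧ s.reg 15 = 0) ∧
          (s.reg 18 = 0 → (s.reg 11 ≠ 0 ↔ s.reg 16 ≠ 0)) ∧
          (s.reg 17 ≠ 0 → (s.reg 13 ≠ 0 ↔ s.reg 11 ≠ 0 ∨ s.reg 14 ≠ 0))
        then s.reg 8 else 0) s := by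
  have hne : ∀ x < 8, x ≠ 8 := by omega
  simp +contextual [testDecide, Prog.wp, State.setReg, hne, hB]

open Classical in
theorem wp_testBody {B n v i j : ℕ} {s : State} (hB : n * n + 1 < B) (hi : i < n) (hj : j < n)
    (hv : v < n) (h₀ : s.reg 0 = n) (h₁ : s.reg 1 = v) (h₅ : s.reg 5 = i * n + j)
    (h₆ : s.reg 6 = i) (h₇ : s.reg 7 = j) :
    testBody.wp B (fun s' => (∀ x < 8, s'.reg x = s.reg x) ∧ s'.arr = s.arr ∧
      s'.reg 8 = if TestOk n v (s.arr 0) (s.arr 1) (s.arr 2) (s.arr 104) (s.arr 105) i j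
        then s.reg 8 else 0) s := by
  refine (wp_testLoad hB hi hj hv h₀ h₁ h₅ h₆ h₇).imp ?_
  rintro s₁ ⟨hr, ha, h₁₁, h₁₂, h₁₃, h₁₄, h₁₅, h₁₆, h₁₇, h₁₈⟩
  refine (wp_testDecide (by omega)).imp ?_
  rintro s₂ ⟨hr₂, ha₂, h₈⟩
  refine ⟨fun x hx => (hr₂ x hx).trans (hr x (by omega)), ha₂.trans ha, ?_⟩
  -- With truncated subtraction the sum of both differences is the distance, which serves as an
  -- equality test.
  have e₁ : i - j + (j - i) ≠ 0 ↔ i ≠ j := by omega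
  have e₂ : i - v + (v - i) = 0 ↔ i = v := by omega
  rw [h₈, h₁₁, h₁₂, h₁₃, h₁₄, h₁₅, h₁₆, h₁₇, h₁₈, hr 8 le_rfl]
  exact if_congr (by rw [e₁, e₂, TestOk]) rfl rfl

end SquareRoot

namespace SquareRoot

/-! ### The tests characterize the root -/

theorem matrix_mul_ne_zero_iff {n : ℕ} (A B : Matrix (Fin n) (Fin n) ℕ) (i j : Fin n) :
    (A * B) i j ≠ 0 ↔ ∃ a, A i a ≠ 0 ∧ B a j ≠ 0 := by
  simp [Matrix.mul_apply, Finset.sum_eq_zero_iff]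

theorem setArray_ne_zero_iff {n : ℕ} (U : Set (Fin n)) (j : Fin n) :
    setArray U j ≠ 0 ↔ j ∈ U := by
  simp [setArray, Fin.val_inj]

theorem adjacency_ne_zero_iff {n : ℕ} (G : SimpleGraph (Fin n)) (i j : Fin n) :
    adjacency G i j ≠ 0 ↔ G.Adj i j := by
  simp [adjacency]

variable {n : ℕ} {G : SimpleGraph (Fin n)} {v : Fin n} {U : Set (Fin n)}
  {A p q : ℕ → ℕ}

/-- Here `p` detects walks of length 2 and `q` walks of length 4, so avoiding both on edges excludes
closed walks of length 3 and 5. By `c3C5Free_iff` this is the required freeness; the other tests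
express `N_H(v) = U` and `H² = G`. -/
theorem forall_testOk_iff {H : SimpleGraph (Fin n)}
    (hA : ∀ i j : Fin n, A (i * n + j) ≠ 0 ↔ H.Adj i j)
    (hp : ∀ i j : Fin n, p (i * n + j) ≠ 0 ↔ ∃ a, H.Adj i a ∧ H.Adj a j)
    (hq : ∀ i j : Fin n, q (i * n + j) ≠ 0 ↔
      ∃ z : Fin n, p (i * n + z) ≠ 0 ∧ p (z * n + j) ≠ 0) :
    (∀ i j : Fin n, TestOk n v (matrixArray (adjacency G)) (setArray U) A p q i j) ↔
      IsRootWithNbhd G v U H := by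
  have hG : ∀ i j : Fin n, matrixArray (adjacency G) (i * n + j) ≠ 0 ↔ G.Adj i j := fun i j => by
    rw [matrixArray_index, adjacency_ne_zero_iff]
  have hp' := fun i j => not_iff_not.2 (hp i j)
  have hq' := fun i j => not_iff_not.2 (hq i j)
  simp only [not_not] at hp' hq'
  simp only [TestOk, hA, hG, hp', hq', hp, setArray_ne_zero_iff, IsRootWithNbhd, c3C5Free_iff,
    ne_eq, Fin.val_inj]
  constructor
  · intro h
    refine ⟨⟨fun x y z hxy hyz hxz => ((h x z).2.1 hxz).2.1 ⟨y, hxy, hyz⟩,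
      fun x a z b y hxa haz hzb hby hxy => ((h x y).2.1 hxy).2.2 ⟨z, ⟨a, hxa, haz⟩, b, hzb, hby⟩⟩,
      ?_, ?_⟩
    · ext x y
      rw [power_two_adj_iff]
      constructor
      · rintro ⟨hne, h'⟩
        exact ((h x y).2.2.2 hne).2 h'
      · exact fun h' => ⟨h'.ne, ((h x y).2.2.2 h'.ne).1 h'⟩
    · ext x
      exact (h v x).2.2.1 rfl
  · rintro ⟨⟨h₃, h₅⟩, rfl, rfl⟩ i j
    refine ⟨H.adj_comm i j, fun hij => ⟨hij.ne, ?_, ?_⟩, ?_, fun hij => ?_⟩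
    · rintro ⟨a, hia, haj⟩
      exact h₃ _ _ _ hia haj hij
    · rintro ⟨z, ⟨a, hia, haz⟩, b, hzb, hbj⟩
      exact h₅ _ _ _ _ _ hia haz hzb hbj hij
    · rintro rfl
      rfl
    · rw [power_two_adj_iff]
      exact ⟨fun h => h.2, fun h => ⟨hij, h⟩⟩

/-- The graph whose adjacency matrix passed the tests. -/
def graphOfTestOk (h : ∀ i j : Fin n, TestOk n v (matrixArray (adjacency G)) (setArray U) A p q i j) :
    SimpleGraph (Fin n) where
  Adj i j := A (i * n + j) ≠ 0
  symm := ⟨fun i j hij => (h i j).1.1 hij⟩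
  loopless := ⟨fun i hi => ((h i i).2.1 hi).1 rfl⟩

/-! ### The program for square roots -/

/-- The multiplier is specified only for input arrays that vanish past the matrix, so the arrays
passed to it must be shown to have this form. -/
theorem eq_matrixArray {f : ℕ → ℕ} (hf : ∀ k, n * n ≤ k → f k = 0) :
    f = matrixArray (n := n) (.of fun i j => f (i * n + j)) := by
  ext k
  unfold matrixArray
  split_ifs with hk
  · simp [Nat.div_add_mod']
  · exact hf k (by omega)

theorem Exec.mul_rename {P : Prog} {B t : ℕ} {f : ℕ → ℕ} (hf : f.Injective)
    {A : Matrix (Fin n) (Fin n) ℕ} {s S : State} (h : Exec B P (mulInput A A) t s)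
    (hs : ∀ i j : Fin n, s.arr 2 (i * n + j) = (A * A) i j)
    (hreg : ∀ x, S.reg (f x) = if x = 0 then n else 0)
    (h₀ : S.arr (f 0) = matrixArray A) (h₁ : S.arr (f 1) = matrixArray A)
    (h₂ : ∀ a, 2 ≤ a → S.arr (f a) = fun _ => 0) :
    ∃ S', Exec B (P.rename f) S t S' ∧
      (∀ i j : Fin n, S'.arr (f 2) (i * n + j) = (A * A) i j) ∧
      (∀ x, (∀ y, f y ≠ x) → S'.reg x = S.reg x) ∧
      (∀ a, (∀ b, f b ≠ a) → S'.arr a = S.arr a) := by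
  have hview : S.view f = mulInput A A := by
    simp only [State.view, mulInput, State.mk.injEq]
    refine ⟨funext hreg, funext fun a => ?_⟩
    match a with
    | 0 => simpa using h₀
    | 1 => simpa using h₁
    | a + 2 => simpa using h₂ (a + 2) (by omega)
  obtain ⟨S', he, hS'⟩ := h.rename hf S hview
  refine ⟨S', he, ?_, fun x hx => he.reg_eq ?_, fun a ha => he.arr_eq ?_⟩
  · rw [← hS'] at hs
    exact hs
  · rw [Prog.writtenRegs_rename, List.mem_map]
    rintro ⟨y, -, hy⟩
    exact hx y hy
  · rw [Prog.writtenArrs_rename, List.mem_map]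
    rintro ⟨y, -, hy⟩
    exact ha y hy

/-- Put the start vertex into the queue, and the size into the inputs of both multiplications. -/
def setup : Prog :=
  .seq (.const 2 1) <| .seq (.store 4 1 2) <| .seq (.const 8 0) <| .seq (.store 3 8 1) <|
  .seq (.const 8 1) <| .seq (.arith .add 100 0 20) (.arith .add 101 0 20)

/-- Register `20` is still zero, so the two additions copy `n`. The zero-filled queue and parent
arrays hold valid vertices because `0 < n`. -/
theorem wp_setup {B : ℕ} (hB : n + 1 < B) :
    setup.wp B (fun s => SearchInv G v U 0 s ∧ s.reg 100 = n ∧ s.reg 101 = n ∧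
      (∀ x, 102 ≤ x → s.reg x = 0) ∧ ∀ a, 100 ≤ a → s.arr a = fun _ => 0) (rootInput G v U) := by
  have hn : 0 < n := v.pos
  simp only [setup, Prog.wp, Op.eval]
  refine ⟨by omega, by omega, by omega, by simpa [rootInput, State.setReg, State.setArr] using by omega,
    by simpa [rootInput, State.setReg, State.setArr] using by omega, ?_, ?_, ?_, ?_, ?_⟩
  · constructor
    case correct =>
      intro H _
      simpa [rootInput, State.setReg, State.setArr] using SearchCorrect.initial _ _
    case queue =>
      simp only [rootInput, State.setReg, State.setArr]
      simpa using forall_update (· < n) (fun _ : ℕ => hn) v.2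
    all_goals simp [rootInput, State.setReg, State.setArr, hn]
  · simp [rootInput, State.setReg, State.setArr]
  · simp [rootInput, State.setReg, State.setArr]
  · intro x hx
    have : x ≠ 0 ∧ x ≠ 1 ∧ x ≠ 2 ∧ x ≠ 8 ∧ x ≠ 100 ∧ x ≠ 101 := by omega
    simp [rootInput, State.setReg, State.setArr, this]
  · intro x hx
    have : x ≠ 0 ∧ x ≠ 1 ∧ x ≠ 3 ∧ x ≠ 4 := by omega
    simp [rootInput, State.setReg, State.setArr, this]

theorem exec_search {B : ℕ} (hG : G.Connected) (hB : n * n + 1 < B) {s : State}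
    (h : SearchInv G v U 0 s) :
    ∃ t s', Exec B searchBody.forGrid s t s' ∧ t ≤ n * n * (searchBody.cost + 5) + 4 ∧
      SearchInv G v U (n * n) s' :=
  exec_forGrid v.pos hB (by decide) (SearchInv.ignoresControl G v U)
    (fun _ hk _ h _ h₂ _ h₆ h₇ => h.wp_searchBody hG hB hk h₂ h₆ h₇) h.reg_zero h

theorem exec_support {B : ℕ} (hn : 0 < n) (hB : n * n + 1 < B) {s : State} (h₀ : s.reg 0 = n)
    (h₁₀₁ : s.arr 101 = fun _ => 0) (h₁₀₃ : s.arr 103 = fun _ => 0) :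
    ∃ t s', Exec B supportBody.forGrid s t s' ∧ t ≤ n * n * (supportBody.cost + 5) + 4 ∧
      s'.arr 101 = (fun i => if i < n * n then if s.arr 104 i = 0 then 0 else 1 else 0) ∧
      s'.arr 103 = (fun i => if i < n * n then if s.arr 104 i = 0 then 0 else 1 else 0) := by
  let I (k : ℕ) (s' : State) : Prop := s'.arr 104 = s.arr 104 ∧
    s'.arr 101 = (fun i => if i < k then if s.arr 104 i = 0 then 0 else 1 else 0) ∧
    s'.arr 103 = (fun i => if i < k then if s.arr 104 i = 0 then 0 else 1 else 0)
  obtain ⟨t, s', he, ht, -, h⟩ := exec_forGrid (B := B) (body := supportBody) (I := I) hn hB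
    (by decide) (fun k s₁ s₂ _ ha h => by simpa only [I, ha] using h)
    (fun k hk s₁ h h₀ h₂ h₅ _ _ => by
      have hup : ∀ f : ℕ → ℕ, f = (fun i => if i < k then if s.arr 104 i = 0 then 0 else 1 else 0) →
          Function.update f k (if s.arr 104 k = 0 then 0 else 1) =
            fun i => if i < k + 1 then if s.arr 104 i = 0 then 0 else 1 else 0 := by
        rintro _ rfl
        ext i
        rw [Function.update_apply]
        by_cases hi : i = k
        · simp [hi]
        · have : i < k + 1 ↔ i < k := by omega
          simp only [hi, this, if_false]
      refine (wp_supportBody (by omega)).imp fun s₂ ⟨_, ha, h₁, h₃⟩ => ⟨?_, ?_, ?_⟩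
      · rw [ha 104 (by omega) (by omega), h.1]
      · rw [h₁, h₅, h.1, hup _ h.2.1]
      · rw [h₃, h₅, h.1, hup _ h.2.2])
    h₀ ⟨rfl, by simp [h₁₀₁], by simp [h₁₀₃]⟩
  exact ⟨t, s', he, ht, h⟩

open Classical in
-- Register `8` starts at 1 and no test ever raises it, so it ends as the conjunction of all tests.
theorem exec_test {B : ℕ} (hB : n * n + 1 < B) (v : Fin n) {s : State} (h₀ : s.reg 0 = n)
    (h₁ : s.reg 1 = v) (h₈ : s.reg 8 = 1) :
    ∃ t s', Exec B testBody.forGrid s t s' ∧ t ≤ n * n * (testBody.cost + 5) + 4 ∧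
      s'.arr = s.arr ∧ s'.reg 8 = if ∀ i j : Fin n,
        TestOk n v (s.arr 0) (s.arr 1) (s.arr 2) (s.arr 104) (s.arr 105) i j then 1 else 0 := by
  let Ok (k : ℕ) : Prop :=
    TestOk n v (s.arr 0) (s.arr 1) (s.arr 2) (s.arr 104) (s.arr 105) (k / n) (k % n)
  let I (k : ℕ) (s' : State) : Prop := s'.arr = s.arr ∧ s'.reg 1 = v ∧
    s'.reg 8 = if ∀ k' < k, Ok k' then 1 else 0
  obtain ⟨t, s', he, ht, ha, -, h⟩ := exec_forGrid (B := B) (body := testBody) (I := I) v.pos hB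
    (by decide)
    (fun k s₁ s₂ hr ha h => by
      simpa only [I, ha, hr 1 (by omega), hr 8 (by omega)] using h)
    (fun k hk s₁ h h₀ h₂ h₅ h₆ h₇ => by
      refine (wp_testBody hB (Nat.div_lt_of_lt_mul hk) (Nat.mod_lt _ v.pos) v.2 h₀ h.2.1
        (h₅.trans (Nat.div_add_mod' k n).symm) h₆ h₇).imp fun s₂ ⟨hr, ha, h₈⟩ =>
        ⟨ha.trans h.1, (hr 1 (by omega)).trans h.2.1, ?_⟩
      rw [h₈, h.2.2, h.1]
      by_cases h' : Ok k
      · rw [if_pos h']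
        exact if_congr (by rw [Nat.forall_lt_succ_right, and_iff_left h']) rfl rfl
      · rw [if_neg h', if_neg fun h'' => h' (h'' k k.lt_succ_self)])
    h₀ ⟨rfl, h₁, by simp [h₈]⟩
  refine ⟨t, s', he, ht, ha, h.trans (if_congr ⟨fun h i j => ?_, fun h k hk => ?_⟩ rfl rfl)⟩
  · have := h _ (index_lt i.2 j.2)
    have h₁ : ((i : ℕ) * n + j) / n = i := by
      rw [mul_comm, Nat.mul_add_div v.pos, Nat.div_eq_of_lt j.2, add_zero]
    have h₂ : ((i : ℕ) * n + j) % n = j := by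
      rw [Nat.mul_add_mod_self_right, Nat.mod_eq_of_lt j.2]
    simpa only [Ok, h₁, h₂] using this
  · exact h ⟨k / n, Nat.div_lt_of_lt_mul hk⟩ ⟨k % n, Nat.mod_lt _ v.pos⟩

/-- The program that constructs square roots: search, square the found matrix, square the support
of its square, and test. -/
def rootProg (P : Prog) : Prog :=
  .seq setup <| .seq searchBody.forGrid <| .seq (P.rename fun x => 2 * x + 100) <|
  .seq supportBody.forGrid <| .seq (P.rename fun x => 2 * x + 101) <| .seq (.const 8 1) <|
  .seq testBody.forGrid <| .seq (.const 9 0) (.arith .add 0 8 9)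

end SquareRoot

/-! ### Correctness and running time of the whole program -/

namespace SquareRoot

open Classical in
/-- A run of `rootProg`: the outcome of the tests decides whether there is a root. -/
theorem exec_rootProg {P : Prog} {n B m : ℕ} {G : SimpleGraph (Fin n)} {v : Fin n}
    {U : Set (Fin n)} (hG : G.Connected) (hB : n * n + 1 < B)
    (hP : ∀ A : Matrix (Fin n) (Fin n) ℕ, (∀ i j, A i j = 0 ∨ A i j = 1) →
      ∃ t s, Exec B P (mulInput A A) t s ∧ t ≤ m ∧
        ∀ i j : Fin n, s.arr 2 (i * n + j) = (A * A) i j) :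
    ∃ t s, Exec B (rootProg P) (rootInput G v U) t s ∧
      t ≤ n * n * (searchBody.cost + supportBody.cost + testBody.cost + 15) + 2 * m +
        (setup.cost + 15) ∧
      s.reg 0 = (if ∃ H, IsRootWithNbhd G v U H then 1 else 0) ∧
      ∀ H, IsRootWithNbhd G v U H → ∀ i j : Fin n, s.arr 2 (i * n + j) = adjacency H i j := by
  have hn := v.pos
  obtain ⟨t₁, s₁, e₁, ht₁, inv₁, r₁₀₀, r₁₀₁, r₁₀₂, a₁⟩ :=
    (wp_setup (G := G) (v := v) (U := U) (show n + 1 < B by nlinarith)).exec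
  obtain ⟨t₂, s₂, e₂, ht₂, inv₂⟩ := exec_search hG hB inv₁
  have regs₂ : ∀ x, 100 ≤ x → s₂.reg x = s₁.reg x := fun x hx => e₂.reg_eq fun h =>
    absurd ((show ∀ x ∈ searchBody.forGrid.writtenRegs, x < 100 by decide) x h) (by omega)
  have arrs₂ : ∀ a, 101 ≤ a → a ≠ 102 → s₂.arr a = fun _ => 0 := fun a ha ha' => by
    rw [e₂.arr_eq fun h => ?_, a₁ a (by omega)]
    have := (show ∀ a ∈ searchBody.forGrid.writtenArrs, a < 101 ∨ a = 102 by decide) a h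
    omega
  -- the first multiplication
  let A : Matrix (Fin n) (Fin n) ℕ := .of fun i j => s₂.arr 2 (i * n + j)
  have hA : s₂.arr 2 = matrixArray A := eq_matrixArray inv₂.outside
  obtain ⟨t₃, z₃, y₃, ht₃, hz₃⟩ := hP A fun i j => inv₂.entry _
  obtain ⟨s₃, e₃, prod₃, regs₃, arrs₃⟩ := y₃.mul_rename (f := fun x => 2 * x + 100)
    (fun x y h => by simpa using h) hz₃
    (S := s₂) (fun x => by
      rw [regs₂ _ (by omega)]
      split_ifs with hx
      · rw [hx]
        exact r₁₀₀
      · exact r₁₀₂ _ (by omega))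
    (inv₂.left.trans hA) (inv₂.right.trans hA) (fun a ha => arrs₂ _ (by omega) (by omega))
  -- The first copy of `P` lives on even cells from 100 on, the second on odd cells from 101 on; so
  -- the second still finds its work space zero.
  have odd₃ : ∀ a, (∀ b, 2 * b + 100 ≠ 2 * a + 101) := by omega
  have low₃ : ∀ a < 100, (∀ b, 2 * b + 100 ≠ a) := by omega
  -- the support of the product
  obtain ⟨t₄, s₄, e₄, ht₄, left₄, right₄⟩ := exec_support hn hB (s := s₃)
    (by rw [regs₃ 0 (low₃ 0 (by omega)), inv₂.reg_zero])
    (by rw [arrs₃ 101 (odd₃ 0), arrs₂ 101 (by omega) (by omega)])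
    (by rw [arrs₃ 103 (odd₃ 1), arrs₂ 103 (by omega) (by omega)])
  have regs₄ : ∀ x, x < 2 ∨ 100 ≤ x → s₄.reg x = s₃.reg x := fun x hx => e₄.reg_eq fun h => by
    have := (show ∀ x ∈ supportBody.forGrid.writtenRegs, 2 ≤ x ∧ x < 100 by decide) x h
    omega
  have arrs₄ : ∀ a, a ≠ 101 → a ≠ 103 → s₄.arr a = s₃.arr a := fun a h₁ h₂ => e₄.arr_eq fun h => by
    have := (show ∀ a ∈ supportBody.forGrid.writtenArrs, a = 101 ∨ a = 103 by decide) a h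
    omega
  -- the second multiplication
  let S : Matrix (Fin n) (Fin n) ℕ := .of fun i j => s₄.arr 101 (i * n + j)
  have hS : s₄.arr 101 = matrixArray S :=
    eq_matrixArray fun k hk => by rw [left₄]; exact if_neg (by omega)
  have entryS : ∀ i j, S i j = 0 ∨ S i j = 1 := fun i j => by
    simp only [S, Matrix.of_apply, left₄]
    split_ifs <;> simp
  obtain ⟨t₅, z₅, y₅, ht₅, hz₅⟩ := hP S entryS
  obtain ⟨s₅, e₅, prod₅, regs₅, arrs₅⟩ := y₅.mul_rename (f := fun x => 2 * x + 101)
    (fun x y h => by simpa using h) hz₅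
    (S := s₄) (fun x => by
      rw [regs₄ _ (by omega), regs₃ _ (odd₃ x), regs₂ _ (by omega)]
      split_ifs with hx
      · rw [hx]
        exact r₁₀₁
      · exact r₁₀₂ _ (by omega))
    hS (right₄.trans (left₄.symm.trans hS)) (fun a ha => by
      rw [arrs₄ _ (by omega) (by omega), arrs₃ _ (odd₃ a), arrs₂ _ (by omega) (by omega)])
  have low₅ : ∀ a < 100, (∀ b, 2 * b + 101 ≠ a) := by omega
  -- the tests
  have e₆ : Exec B (.const 8 1) s₅ 1 (s₅.setReg 8 1) := .const _ _ _ (by omega)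
  have reg₅ : ∀ x < 2, s₅.reg x = s₂.reg x := fun x hx => by
    rw [regs₅ x (low₅ x (by omega)), regs₄ x (by omega), regs₃ x (low₃ x (by omega))]
  have arr₅ : ∀ a < 100, s₅.arr a = s₂.arr a := fun a ha => by
    rw [arrs₅ a (low₅ a ha), arrs₄ a (by omega) (by omega), arrs₃ a (low₃ a ha)]
  obtain ⟨t₇, s₇, e₇, ht₇, arr₇, reg₇⟩ := exec_test hB v (s := s₅.setReg 8 1)
    (by simp [State.setReg, reg₅, inv₂.reg_zero]) (by simp [State.setReg, reg₅, inv₂.reg_one])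
    (by simp [State.setReg])
  have e₈ : Exec B (.const 9 0) s₇ 1 (s₇.setReg 9 0) := .const _ _ _ (by omega)
  have e₉ := Exec.arith (B := B) .add 0 8 9 (s₇.setReg 9 0) (by
    simp only [Op.eval, State.setReg]
    simp only [Function.update_self, Function.update_of_ne (show 8 ≠ 9 by omega), reg₇]
    split_ifs <;> omega)
  have set₅ : (s₅.setReg 8 1).arr = s₅.arr := rfl
  rw [set₅] at arr₇ reg₇
  rw [arr₅ 0 (by omega), arr₅ 1 (by omega), arr₅ 2 (by omega), inv₂.graph, inv₂.nbhd] at reg₇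
  -- the meaning of the tests
  have p₃ : ∀ i j : Fin n, s₅.arr 104 (i * n + j) = (A * A) i j := fun i j => by
    rw [arrs₅ 104 (by omega), arrs₄ 104 (by omega) (by omega)]
    exact prod₃ i j
  have hSA : ∀ i j, S i j ≠ 0 ↔ s₅.arr 104 (i * n + j) ≠ 0 := fun i j => by
    rw [arrs₅ 104 (by omega), arrs₄ 104 (by omega) (by omega)]
    simp [S, left₄, index_lt i.2 j.2]
  have hq : ∀ i j : Fin n, s₅.arr 105 (i * n + j) ≠ 0 ↔
      ∃ z : Fin n, s₅.arr 104 (i * n + z) ≠ 0 ∧ s₅.arr 104 (z * n + j) ≠ 0 := fun i j => by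
    rw [show s₅.arr 105 (i * n + j) = (S * S) i j from prod₅ i j, matrix_mul_ne_zero_iff]
    simp only [hSA]
  have hroot : ∀ H : SimpleGraph (Fin n), (∀ i j, A i j ≠ 0 ↔ H.Adj i j) →
      ((∀ i j : Fin n, TestOk n v (matrixArray (adjacency G)) (setArray U) (s₂.arr 2) (s₅.arr 104)
        (s₅.arr 105) i j) ↔ IsRootWithNbhd G v U H) := fun H hH =>
    forall_testOk_iff hH (fun i j => by
      rw [p₃, matrix_mul_ne_zero_iff]
      simp only [hH]) hq
  have hfinal : ∀ H, IsRootWithNbhd G v U H → ∀ i j : Fin n, A i j = adjacency H i j := by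
    intro H hH i j
    have hc := inv₂.correct H hH
    obtain ⟨-, rfl, -⟩ := hH
    exact hc.final hG inv₂.queue i j
  refine ⟨_, _, .seq e₁ (.seq e₂ (.seq e₃ (.seq e₄ (.seq e₅ (.seq e₆ (.seq e₇
    (.seq e₈ e₉))))))), ?_, ?_, ?_⟩
  · simp only [mul_add] at ht₂ ht₄ ht₇ ⊢
    omega
  · simp only [Op.eval, State.setReg, Function.update_self,
      Function.update_of_ne (show 8 ≠ 9 by omega), add_zero, reg₇]
    -- Passed tests yield a root without appeal to the search; its correctness enters only in the
    -- converse, where `hfinal` says that the matrix found is that of the given root.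
    refine if_congr ⟨fun h => ⟨graphOfTestOk h, (hroot (graphOfTestOk h) fun i j => Iff.rfl).1 h⟩,
      ?_⟩ rfl rfl
    rintro ⟨H, hH⟩
    refine (hroot H fun i j => ?_).2 hH
    rw [hfinal H hH, adjacency_ne_zero_iff]
  · intro H hH i j
    simp only [State.setReg, arr₇, arr₅ 2 (by omega)]
    exact hfinal H hH i j

theorem MultipliesMatricesIn.exists_constructsRootIn {P : Prog} {M : ℕ → ℕ}
    (h : MultipliesMatricesIn P M) :
    ∃ (Q : Prog) (C : ℕ), ConstructsRootIn Q (fun n => C * M n) := by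
  have hsq : ∀ {n : ℕ}, 0 < n → n * n ≤ M n := h.sq_le
  obtain ⟨c, h⟩ := h
  refine ⟨rootProg P, searchBody.cost + supportBody.cost + testBody.cost + 15 + 2 +
    (setup.cost + 15), c + 2, fun n G v U hG _ => ?_⟩
  have hn := v.pos
  -- The extra exponent 2 makes room for the position counters, also when `c = 0`.
  have hB : n * n + 1 < (n + 2) ^ (c + 2) := by
    have : (n + 2) ^ 2 ≤ (n + 2) ^ (c + 2) := Nat.pow_le_pow_right (by omega) (by omega)
    nlinarith
  obtain ⟨t, s, he, ht, h₀, h₂⟩ := exec_rootProg (P := P) (m := M n) (v := v) (U := U) hG hB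
    fun A hA => by
      obtain ⟨t, s, he, ht, hs⟩ := h n A A hA hA
      exact ⟨t, s, he.mono (Nat.pow_le_pow_right (by omega) (by omega)), ht, hs⟩
  refine ⟨t, s, he, ht.trans ?_, fun hex => ?_, fun hex => by rw [h₀, if_neg hex]⟩
  · have hM := hsq hn
    have h₁ : 1 ≤ M n := (Nat.mul_pos hn hn).trans_le hM
    generalize searchBody.cost + supportBody.cost + testBody.cost + 15 = a
    generalize setup.cost + 15 = b
    have := Nat.mul_le_mul_right a hM
    have := Nat.mul_le_mul_left b h₁
    simp only [add_mul, mul_comm a] at *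
    omega
  · refine ⟨by rw [h₀, if_pos hex], ?_⟩
    obtain ⟨H, hH⟩ := hex
    exact ⟨H, hH, h₂ H hH⟩

end SquareRoot

open SquareRoot in
theorem mainTheorem6 :
    -- the neighborhood of an end of an edge of the root is determined by that of the other end
    (∀ (V : Type*) [Finite V] (G H : SimpleGraph V), C3C5Free H → power H 2 = G →
      ∀ x y : V, y ∈ H.neighborSet x →
        H.neighborSet y = G.neighborSet y ∩ (insert x (G.neighborSet x) \ H.neighborSet x)) ∧
    -- there is at most one solution
    (∀ (V : Type*) [Finite V] (G : SimpleGraph V), G.Connected →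
      ∀ (v : V) (U : Set V), U ⊆ G.neighborSet v →
        ∀ H₁ H₂ : SimpleGraph V, IsRootWithNbhd G v U H₁ → IsRootWithNbhd G v U H₂ → H₁ = H₂) ∧
    -- it is constructed within a constant factor of the time of any matrix multiplication
    (∀ (P : Prog) (M : ℕ → ℕ), MultipliesMatricesIn P M →
      ∃ (Q : Prog) (C : ℕ), ConstructsRootIn Q (fun n => C * M n)) := by
  refine ⟨?_, ?_, fun P M h => h.exists_constructsRootIn⟩
  · rintro V _ _ H hH rfl x y hxy
    exact neighborSet_eq_of_adj hH hxy
  · exact fun V _ G hG v U _ H₁ H₂ h₁ h₂ => h₁.unique hG h₂
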